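/- **Setting.** Fix a finite set $\mathcal R$ of kinds of resources, and countably infinite sets $\mathcal I$ of interface names and $\mathcal Z$ of microservice names. For a partial function $f$, $\mathrm{dom}(f)$ is its domain. *Types.* A *microservice type* is a tuple $\mathcal T=\langle P,D_s,D_w,C,R\rangle$, where $P$ is a finite partial function from $\mathcal I$ to $\{1,2,\dots\}\cup\{\infty\}$ (provided interfaces, with the maximal number of connected microservices), $D_s$ is a finite partial function from $\mathcal I$ to $\{1,2,\dots\}$ and $D_w$ is a finite partial function from $\mathcal I$ to $\mathbb N$ (strong and weak required interfaces, with the minimal number of connected microservices), $C\subseteq\mathcal I$ is finite (conflicting interfaces), $R:\mathcal R\to\mathbb N$ (resource consumption), and $\mathrm{dom}(D_s)$, $\mathrm{dom}(D_w)$, $C$ are pairwise disjoint. A finite set $U$ of types (a *universe*) is *well-formed* if the directed graph on $U$ with an edge from $\mathcal T$ to $\mathcal T'$ whenever some interface is strongly required by $\mathcal T$ and provided by $\mathcal T'$ has no directed cycle (loops included). A *node* $o$ has a name, a resource availability $o.\mathrm{res}:\mathcal R\to\mathbb N$ and a cost $o.\mathrm{cost}\in\mathbb N$. *Configurations.* A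 *configuration* $\langle Z,T,N,B\rangle$ consists of a finite set $Z\subseteq\mathcal Z$ of deployed microservices, functions $T$ and $N$ giving the type and the hosting node of each $z\in Z$, and a set $B\subseteq\mathcal I\times Z\times Z$ of bindings such that for $(p,z_1,z_2)\in B$ we have $z_1\ne z_2$, $p$ is (strongly or weakly) required by $T(z_1)$, and $p$ is provided by $T(z_2)$. It is *provisionally correct* if (i) for each node $o$ in the range of $N$ and each $r\in\mathcal R$, the sum of the consumptions of $r$ of the types $T(z)$ over all $z\in Z$ with $N(z)=o$ is at most $o.\mathrm{res}(r)$; (ii) if $T(z)$ strongly requires $p$ with constraint $n$, then $(p,z,z')\in B$ for at least $n$ distinct $z'$; (iii) if $T(z)$ provides $p$ with capacity $n$, then $(p,z',z)\in B$ for at most $n$ distinct $z'$. It is *correct* if moreover (ii) holds for weak required interfaces, and whenever $p$ is a conflicting interface of $T(z)$, no $z'\in Z\setminus\{z\}$ has a type that provides $p$. *Actions.* The actions on a configuration $\langle Z,T,N,B\rangle$ are: - $\mathit{bind}(p,z_1,z_2)$ and $\mathit{unbind}(p,z_1,z_2)$, where $z_1\neq z_2$ are in $Z$, $T(z_1)$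 weakly requires $p$ and $T(z_2)$ provides $p$: add the binding $(p,z_1,z_2)$, which must be absent, respectively remove it, which must be present; - $\mathit{new}(z,\mathcal T,o,B_s)$, where $z\in\mathcal Z\setminus Z$, $\mathcal T$ is a type, $o$ is a node, and $B_s$ assigns to each strong required interface $p$ of $\mathcal T$ with constraint $n$ a set of at least $n$ microservices of $Z$ whose types provide $p$: add $z$ with type $\mathcal T$ on node $o$, with the bindings $(p,z,z')$ for $z'\in B_s(p)$; - $\mathit{del}(z)$: remove $z$ and all bindings involving it. *The optimal deployment problem.* The input consists of a well-formed universe $U$, a finite set $O$ of nodes, a provisionally correct configuration $\mathcal C_0$ and a type $\mathcal T_t\in U$. A *solution* is a finite, possibly empty, sequence of actions leading from $\mathcal C_0$ through configurations $\mathcal C_1,\dots,\mathcal C_m$ such that each $\mathcal C_i$ with $1\le i\le m$ is provisionally correct and has only types in $U$ and only nodes in $O$, while $\mathcal C_m$ is correct and contains a microservice of type $\mathcal T_t$. Its *cost* is the sum of $o.\mathrm{cost}$ over the nodes $o$ that host at least one microservice of $\mathcal C_m$. The output required is a solution of minimal cost if a solution exists, and "no" otherwise. **Theorem.** For every finite set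 $\mathcal R$, the optimal deployment problem is decidable: there is a computable function that maps every input (finitely encoded) to a solution whose cost is minimal among all solutions, if a solution exists, and to "no" otherwise. -/

import Mathlib

/-! ### Encoding finite sets: a finite set is coded by the list of its elements,
in increasing order of their codes. -/

section FinsetCoding

variable {α : Type*} [Primcodable α]

theorem primrecPred_pairwise_encode_lt :
    PrimrecPred fun l : List α => l.Pairwise (fun a b => Encodable.encode a < Encodable.encode b) := by
  classical
  have hR : PrimrecRel fun (b a : α) => Encodable.encode a < Encodable.encode b :=
    Primrec.nat_lt.comp (Primrec.encode.comp Primrec.snd) (Primrec.encode.comp Primrec.fst)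
  obtain ⟨_, hall⟩ := hR.forall_mem_list
  have hstep : Primrec₂ fun (_ : List α) (p : α × List α × Bool) =>
      (decide (∀ b ∈ p.2.1, Encodable.encode p.1 < Encodable.encode b) && p.2.2) := by
    refine Primrec.and.comp ?_ ?_
    · refine (hall.comp (Primrec.pair
        (Primrec.fst.comp (Primrec.snd.comp Primrec.snd))
        (Primrec.fst.comp Primrec.snd))).of_eq fun p => ?_
      congr
    · exact Primrec.snd.comp (Primrec.snd.comp Primrec.snd)
  refine ⟨inferInstance, ?_⟩
  refine (Primrec.list_rec Primrec.id (Primrec.const true) hstep).of_eq fun l => ?_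
  induction l with
  | nil => simp
  | cons a l ih => simp only [id] at ih ⊢; simp [ih]

/-- Finite sets correspond to lists whose elements have strictly increasing codes. -/
noncomputable def finsetEquivSortedList (α : Type*) [Encodable α] :
    Finset α ≃ {l : List α // l.Pairwise (fun a b => Encodable.encode a < Encodable.encode b)} := by
  classical
  letI r : α → α → Prop := fun a b => Encodable.encode a ≤ Encodable.encode b
  haveI : IsTrans α r := ⟨fun _ _ _ h h' => le_trans h h'⟩
  haveI : Std.Antisymm r := ⟨fun _ _ h h' => Encodable.encode_injective (le_antisymm h h')⟩
  haveI : Std.Total r := ⟨fun a b => le_total (Encodable.encode a) (Encodable.encode b)⟩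
  exact
    { toFun := fun s => ⟨s.sort r, by
        have h := (s.pairwise_sort r).and (s.sort_nodup r)
        exact h.imp fun h => lt_of_le_of_ne h.1 (fun e => h.2 (Encodable.encode_injective e))⟩
      invFun := fun l => l.1.toFinset
      left_inv := fun s => s.sort_toFinset r
      right_inv := fun l => by
        apply Subtype.ext
        have hn : l.1.Nodup := l.2.imp fun h e => by subst e; exact lt_irrefl _ h
        exact (List.toFinset_sort r hn).2 (l.2.imp fun h => le_of_lt h) }

open Classical in
noncomputable instance Finset.instPrimcodable : Primcodable (Finset α) :=
  letI : Primcodable {l : List α //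
      l.Pairwise (fun a b => Encodable.encode a < Encodable.encode b)} :=
    Primcodable.subtype primrecPred_pairwise_encode_lt
  Primcodable.ofEquiv _ (finsetEquivSortedList α)

end FinsetCoding

instance ENat.instPrimcodable : Primcodable ℕ∞ :=
  inferInstanceAs (Primcodable (Option ℕ))

namespace Microservice

/-! ### Finite partial functions, as functional graphs -/

/-- The domain of a partial function given by its graph. -/
def dom {α β : Type*} [DecidableEq α] (f : Finset (α × β)) : Finset α := f.image Prod.fst

/-- The range of a partial function given by its graph. -/
def ran {α β : Type*} [DecidableEq β] (f : Finset (α × β)) : Finset β := f.image Prod.snd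

/-- `f` is the graph of a partial function. -/
def Functional {α β : Type*} (f : Finset (α × β)) : Prop :=
  ∀ a b b', (a, b) ∈ f → (a, b') ∈ f → b = b'

/-! ### Microservice types, nodes, configurations, actions

Interfaces and microservices are named by natural numbers, and there are `k` kinds of resources. -/

/-- The data of a microservice type; `MType.IsType` below says when it is a microservice type. -/
structure MType (k : ℕ) where
  /-- provided interfaces, with their capacities -/
  prov : Finset (ℕ × ℕ∞)
  /-- strong required interfaces -/
  reqS : Finset (ℕ × ℕ)
  /-- weak required interfaces -/
  reqW : Finset (ℕ × ℕ)
  /-- conflicting interfaces -/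
  conf : Finset ℕ
  /-- resource consumption -/
  res : Fin k → ℕ
deriving DecidableEq

/-- Membership in the set of microservice types. -/
structure MType.IsType {k : ℕ} (T : MType k) : Prop where
  prov_functional : Functional T.prov
  prov_pos : ∀ p n, (p, n) ∈ T.prov → n ≠ 0
  reqS_functional : Functional T.reqS
  reqS_pos : ∀ p n, (p, n) ∈ T.reqS → n ≠ 0
  reqW_functional : Functional T.reqW
  disjoint_reqS_reqW : Disjoint (dom T.reqS) (dom T.reqW)
  disjoint_reqS_conf : Disjoint (dom T.reqS) T.conf
  disjoint_reqW_conf : Disjoint (dom T.reqW) T.conf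

/-- A node: its name, with the resources it provides and its cost. -/
structure Node (k : ℕ) where
  name : ℕ
  res : Fin k → ℕ
  cost : ℕ
deriving DecidableEq

/-- The data of a configuration; `Config.IsConfig` below says when it is a configuration. -/
structure Config (k : ℕ) where
  /-- the deployed microservices -/
  Z : Finset ℕ
  /-- the graph of the function giving their types -/
  T : Finset (ℕ × MType k)
  /-- the graph of the function giving the nodes that host them -/
  N : Finset (ℕ × Node k)
  /-- the bindings (interface, requirer, provider) -/
  B : Finset (ℕ × ℕ × ℕ)
deriving DecidableEq

/-- `C` is a configuration: `T` and `N` are total functions on `Z`, with values in the microservice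
types and in the nodes, and each binding joins two distinct deployed microservices, through an
interface that the first requires and the second provides. -/
structure Config.IsConfig {k : ℕ} (C : Config k) : Prop where
  T_functional : Functional C.T
  dom_T : dom C.T = C.Z
  isType : ∀ z T, (z, T) ∈ C.T → T.IsType
  N_functional : Functional C.N
  dom_N : dom C.N = C.Z
  binding : ∀ p z₁ z₂, (p, z₁, z₂) ∈ C.B → z₁ ≠ z₂ ∧
    ∃ T₁ T₂, (z₁, T₁) ∈ C.T ∧ (z₂, T₂) ∈ C.T ∧
      p ∈ dom T₁.reqS ∪ dom T₁.reqW ∧ p ∈ dom T₂.prov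

/-- In `C`, there are `n` distinct microservices, different from `z`, that provide `p` and to which
`z` is bound on `p`. -/
def Config.HasProviders {k : ℕ} (C : Config k) (p z n : ℕ) : Prop :=
  ∃ S : Finset ℕ, S ⊆ C.Z.erase z ∧ S.card = n ∧
    ∀ z' ∈ S, (p, z, z') ∈ C.B ∧ ∃ T', (z', T') ∈ C.T ∧ p ∈ dom T'.prov

/-- In `C`, there are `m` distinct microservices, different from `z`, that require `p` and are
bound to `z` on `p`. -/
def Config.HasRequirers {k : ℕ} (C : Config k) (p z m : ℕ) : Prop :=
  ∃ S : Finset ℕ, S ⊆ C.Z.erase z ∧ S.card = m ∧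
    ∀ z' ∈ S, (p, z', z) ∈ C.B ∧ ∃ T', (z', T') ∈ C.T ∧ p ∈ dom T'.reqS ∪ dom T'.reqW

/-- Provisionally correct configurations. -/
structure Config.ProvCorrect {k : ℕ} (C : Config k) : Prop where
  isConfig : C.IsConfig
  resources : ∀ o ∈ ran C.N, ∀ r : Fin k,
    ∑ x ∈ C.T with (x.1, o) ∈ C.N, x.2.res r ≤ o.res r
  strong : ∀ z T, (z, T) ∈ C.T → ∀ p n, (p, n) ∈ T.reqS → C.HasProviders p z n
  capacity : ∀ z T, (z, T) ∈ C.T → ∀ p n, (p, n) ∈ T.prov →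
    ¬ ∃ m : ℕ, n < (m : ℕ∞) ∧ C.HasRequirers p z m

/-- Correct configurations. -/
structure Config.Correct {k : ℕ} (C : Config k) : Prop where
  provCorrect : C.ProvCorrect
  weak : ∀ z T, (z, T) ∈ C.T → ∀ p n, (p, n) ∈ T.reqW → C.HasProviders p z n
  noConflict : ∀ z T, (z, T) ∈ C.T → ∀ p ∈ T.conf,
    ∀ z' T', (z', T') ∈ C.T → z' ≠ z → p ∉ dom T'.prov

/-- The data of actions; `Action.IsAction` below gives their side conditions. In
`new z T o Bs`, the finite set `Bs` is the graph of a function to sets of microservices. -/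
inductive Action (k : ℕ) where
  | bind (p z₁ z₂ : ℕ)
  | unbind (p z₁ z₂ : ℕ)
  | new (z : ℕ) (T : MType k) (o : Node k) (Bs : Finset (ℕ × Finset ℕ))
  | del (z : ℕ)

/-- Membership in the set of actions. -/
def Action.IsAction {k : ℕ} : Action k → Prop
  | .bind _ z₁ z₂ => z₁ ≠ z₂
  | .unbind _ z₁ z₂ => z₁ ≠ z₂
  | .new z T _ Bs => T.IsType ∧ Functional Bs ∧ dom Bs = dom T.reqS ∧
      (∀ p S, (p, S) ∈ Bs → z ∉ S) ∧
      ∀ p S n, (p, S) ∈ Bs → (p, n) ∈ T.reqS → n ≤ S.card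
  | .del _ => True

/-- `p` is a weak required interface of `z₁` and a provided interface of `z₂`. -/
def Config.WeakPort {k : ℕ} (C : Config k) (p z₁ z₂ : ℕ) : Prop :=
  ∃ T₁ T₂, (z₁, T₁) ∈ C.T ∧ (z₂, T₂) ∈ C.T ∧ p ∈ dom T₁.reqW ∧ p ∈ dom T₂.prov

/-- Transitions: executing the action on the configuration `C` produces `C'`. -/
def Step {k : ℕ} (C : Config k) (a : Action k) (C' : Config k) : Prop :=
  a.IsAction ∧
  match a with
  | .bind p z₁ z₂ => (p, z₁, z₂) ∉ C.B ∧ C.WeakPort p z₁ z₂ ∧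
      C' = ⟨C.Z, C.T, C.N, insert (p, z₁, z₂) C.B⟩
  | .unbind p z₁ z₂ => (p, z₁, z₂) ∈ C.B ∧ C.WeakPort p z₁ z₂ ∧
      C' = ⟨C.Z, C.T, C.N, C.B.erase (p, z₁, z₂)⟩
  | .new z T o Bs => z ∉ C.Z ∧
      (∀ p S, (p, S) ∈ Bs → ∀ z' ∈ S, ∃ T', (z', T') ∈ C.T ∧ p ∈ dom T'.prov) ∧
      C' = ⟨insert z C.Z, insert (z, T) C.T, insert (z, o) C.N,
        C.B ∪ Bs.biUnion fun x => x.2.image fun z' => (x.1, z, z')⟩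
  | .del z => C' = ⟨C.Z.erase z, C.T.filter (fun x => z ≠ x.1), C.N.filter (fun x => z ≠ x.1),
        C.B.filter (fun b => z ≠ b.2.1 ∧ z ≠ b.2.2)⟩

/-- `Steps C [a₁, …, aₘ] [C₁, …, Cₘ]`: the actions lead from `C` to `C₁`, …, and to `Cₘ`. -/
inductive Steps {k : ℕ} : Config k → List (Action k) → List (Config k) → Prop
  | nil (C : Config k) : Steps C [] []
  | cons {C : Config k} {a : Action k} {C' : Config k} {as : List (Action k)}
      {Cs : List (Config k)} : Step C a C' → Steps C' as Cs → Steps C (a :: as) (C' :: Cs)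

/-- `as` is a deployment plan from `C₀`, through the configurations `Cs`; the last configuration is
`C₀` itself if the plan is empty. -/
structure IsDeploymentPlan {k : ℕ} (C₀ : Config k) (as : List (Action k)) (Cs : List (Config k)) :
    Prop where
  steps : Steps C₀ as Cs
  provCorrect : ∀ C ∈ Cs, C.ProvCorrect
  correct : (Cs.getLastD C₀).Correct

/-- The total cost of the nodes used in a configuration. -/
def Config.cost {k : ℕ} (C : Config k) : ℕ := ∑ o ∈ ran C.N, o.cost

/-! ### Universes and the optimal deployment problem -/

/-- The edges of the strong dependency graph of `U`. -/
def StrongDep {k : ℕ} (U : Finset (MType k)) (T T' : MType k) : Prop :=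
  T ∈ U ∧ T' ∈ U ∧ ∃ p, p ∈ dom T.reqS ∩ dom T'.prov

/-- `U` is a well-formed universe: the strong dependency graph has no directed cycle. -/
def WellFormed {k : ℕ} (U : Finset (MType k)) : Prop :=
  ∀ T, ¬ Relation.TransGen (StrongDep U) T T

/-- The data of an input of the optimal deployment problem. -/
structure Input (k : ℕ) where
  /-- the universe -/
  U : Finset (MType k)
  /-- the available nodes -/
  O : Finset (Node k)
  /-- the initial configuration -/
  C₀ : Config k
  /-- the target type -/
  target : MType k

/-- The inputs of the optimal deployment problem. -/
structure Input.Valid {k : ℕ} (I : Input k) : Prop where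
  isType : ∀ T ∈ I.U, T.IsType
  wellFormed : WellFormed I.U
  provCorrect : I.C₀.ProvCorrect
  target_mem : I.target ∈ I.U

/-- `as` is a deployment plan (through the configurations `Cs`) that uses only the types of the
universe and the available nodes, and deploys a microservice of the target type. -/
structure Input.IsSolution {k : ℕ} (I : Input k) (as : List (Action k)) (Cs : List (Config k)) :
    Prop where
  plan : IsDeploymentPlan I.C₀ as Cs
  types : ∀ C ∈ Cs, ∀ z T, (z, T) ∈ C.T → T ∈ I.U
  nodes : ∀ C ∈ Cs, ∀ z o, (z, o) ∈ C.N → o ∈ I.O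
  target : ∃ z, (z, I.target) ∈ (Cs.getLastD I.C₀).T

/-- `as` is a solution whose final configuration has the least cost among all solutions. -/
def Input.IsOptimal {k : ℕ} (I : Input k) (as : List (Action k)) : Prop :=
  ∃ Cs, I.IsSolution as Cs ∧
    ∀ as' Cs', I.IsSolution as' Cs' → (Cs.getLastD I.C₀).cost ≤ (Cs'.getLastD I.C₀).cost

/-! ### Encoding the inputs and outputs -/

def MType.equivProd (k : ℕ) : MType k ≃
    Finset (ℕ × ℕ∞) × Finset (ℕ × ℕ) × Finset (ℕ × ℕ) × Finset ℕ × (Fin k → ℕ) where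
  toFun T := (T.prov, T.reqS, T.reqW, T.conf, T.res)
  invFun x := ⟨x.1, x.2.1, x.2.2.1, x.2.2.2.1, x.2.2.2.2⟩

noncomputable instance (k : ℕ) : Primcodable (MType k) := Primcodable.ofEquiv _ (MType.equivProd k)

def Node.equivProd (k : ℕ) : Node k ≃ ℕ × (Fin k → ℕ) × ℕ where
  toFun o := (o.name, o.res, o.cost)
  invFun x := ⟨x.1, x.2.1, x.2.2⟩

noncomputable instance (k : ℕ) : Primcodable (Node k) := Primcodable.ofEquiv _ (Node.equivProd k)

def Config.equivProd (k : ℕ) : Config k ≃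
    Finset ℕ × Finset (ℕ × MType k) × Finset (ℕ × Node k) × Finset (ℕ × ℕ × ℕ) where
  toFun C := (C.Z, C.T, C.N, C.B)
  invFun x := ⟨x.1, x.2.1, x.2.2.1, x.2.2.2⟩

noncomputable instance (k : ℕ) : Primcodable (Config k) :=
  Primcodable.ofEquiv _ (Config.equivProd k)

def Action.equivSum (k : ℕ) : Action k ≃
    ((ℕ × ℕ × ℕ) ⊕ (ℕ × ℕ × ℕ)) ⊕ ((ℕ × MType k × Node k × Finset (ℕ × Finset ℕ)) ⊕ ℕ) where
  toFun
    | .bind p z₁ z₂ => .inl (.inl (p, z₁, z₂))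
    | .unbind p z₁ z₂ => .inl (.inr (p, z₁, z₂))
    | .new z T o Bs => .inr (.inl (z, T, o, Bs))
    | .del z => .inr (.inr z)
  invFun
    | .inl (.inl (p, z₁, z₂)) => .bind p z₁ z₂
    | .inl (.inr (p, z₁, z₂)) => .unbind p z₁ z₂
    | .inr (.inl (z, T, o, Bs)) => .new z T o Bs
    | .inr (.inr z) => .del z
  left_inv a := by cases a <;> rfl
  right_inv x := by rcases x with (⟨_, _, _⟩ | ⟨_, _, _⟩) | (⟨_, _, _, _⟩ | _) <;> rfl

noncomputable instance (k : ℕ) : Primcodable (Action k) := Primcodable.ofEquiv _ (Action.equivSum k)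

def Input.equivProd (k : ℕ) : Input k ≃
    Finset (MType k) × Finset (Node k) × Config k × MType k where
  toFun I := (I.U, I.O, I.C₀, I.target)
  invFun x := ⟨x.1, x.2.1, x.2.2.1, x.2.2.2⟩

noncomputable instance (k : ℕ) : Primcodable (Input k) := Primcodable.ofEquiv _ (Input.equivProd k)

end Microservice

/-!
A nonempty solution with final configuration `F` exists if and only if `F` is correct, uses only the
given types and nodes, contains the target type, and some action leads from the initial
configuration to an admissible one, that is, to a provisionally correct configuration with the given
types and nodes (`CanStart`, `IsFinal`). Indeed, as the strong dependency graph
of a well-formed universe has no cycle, the microservices of any admissible configuration can be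
deleted one after the other, each being deleted before the strong providers it depends on; in the
opposite order, they can be created from the empty configuration, and the weak bindings are added
afterwards. So all admissible configurations are connected (`Admissible.reach`), and it remains to
search for correct configurations.

This search can be restricted to configurations of computably bounded size
(`IsDeployment.exists_card_le`): from a large correct configuration, some microservices can be
removed without losing correctness or increasing the cost. Removal is harmless for resources and
conflicts, so only the requirements matter. Assign to each microservice the vector that records, for
each interface, how many bindings to providers of finite capacity it receives minus how many of them
it uses. These vectors have bounded entries and their sum over all microservices is zero, so a large
set of microservices contains a nonempty subset whose vectors have sum zero
(`exists_zero_sum_subset`). When such a subset is removed, the remaining capacities match the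
remaining demands in total, and a switching argument rearranges the bindings so that all demands are
met (`IsAssignment.exists_saturated`). Boundedly many microservices are protected from removal, to
keep the target, the required providers of infinite capacity, and room for the switching.

Consequently, the statement that all solutions have cost at least `c` is equivalent to a primitive
recursive test (`costAtLeast_iff`). A solution together with a successful test for its own cost, or
a successful test for the cost `⊤`, exists for every valid input, and an unbounded search for it is
computable.
-/

/-! ### Primitive recursive operations on finite sets -/

-- With these attributes, `fun_prop` proves that expressions without bound variables are primitive
-- recursive; quantifiers, sums, images and set-builders are treated by explicit lemmas.
attribute [fun_prop] Primrec PrimrecPred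
attribute [fun_prop] Primrec.id Primrec.const Primrec.comp Primrec.fst Primrec.snd Primrec.pair
attribute [fun_prop] PrimrecPred.and PrimrecPred.or PrimrecPred.not

/-- The elements of a finite set, in increasing order of their codes. -/
noncomputable def Finset.sortedList {α : Type*} [Primcodable α] (s : Finset α) : List α :=
  (finsetEquivSortedList α s).1

@[simp]
theorem Finset.mem_sortedList {α : Type*} [Primcodable α] {s : Finset α} {a : α} :
    a ∈ s.sortedList ↔ a ∈ s := by
  simp [sortedList, finsetEquivSortedList]

theorem Finset.nodup_sortedList {α : Type*} [Primcodable α] (s : Finset α) :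
    s.sortedList.Nodup :=
  (finsetEquivSortedList α s).2.imp fun h e => by subst e; exact lt_irrefl _ h

section Primrec

variable {α β γ σ : Type*} [Primcodable α] [Primcodable β] [Primcodable γ] [Primcodable σ]

@[fun_prop]
theorem PrimrecPred.const (p : Prop) : PrimrecPred fun _ : α => p := by
  classical
  exact ⟨fun _ => inferInstance, Primrec.const _⟩

@[fun_prop]
theorem PrimrecPred.imp {p q : α → Prop} (hp : PrimrecPred p) (hq : PrimrecPred q) :
    PrimrecPred fun a => p a → q a :=
  (hp.not.or hq).of_eq fun _ => by tauto

@[fun_prop]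
theorem PrimrecPred.eq {f g : α → β} (hf : Primrec f) (hg : Primrec g) :
    PrimrecPred fun a => f a = g a :=
  Primrec.eq.comp hf hg

@[fun_prop]
theorem PrimrecPred.ne {f g : α → β} (hf : Primrec f) (hg : Primrec g) :
    PrimrecPred fun a => f a ≠ g a :=
  (Primrec.eq.comp hf hg).not

@[fun_prop]
theorem PrimrecPred.nat_le {f g : α → ℕ} (hf : Primrec f) (hg : Primrec g) :
    PrimrecPred fun a => f a ≤ g a :=
  Primrec.nat_le.comp hf hg

@[fun_prop]
theorem PrimrecPred.nat_lt {f g : α → ℕ} (hf : Primrec f) (hg : Primrec g) :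
    PrimrecPred fun a => f a < g a :=
  Primrec.nat_lt.comp hf hg

@[fun_prop]
theorem Primrec.add_comp {f g : α → ℕ} (hf : Primrec f) (hg : Primrec g) :
    Primrec fun a => f a + g a :=
  Primrec.nat_add.comp hf hg

@[fun_prop]
theorem Primrec.mul_comp {f g : α → ℕ} (hf : Primrec f) (hg : Primrec g) :
    Primrec fun a => f a * g a :=
  Primrec.nat_mul.comp hf hg

theorem PrimrecPred.forall_list {f : α → List β} {p : α → β → Prop} (hf : Primrec f)
    (hp : PrimrecPred fun x : α × β => p x.1 x.2) : PrimrecPred fun a => ∀ b ∈ f a, p a b :=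
  PrimrecRel.comp (R := fun (l : List β) a => ∀ b ∈ l, p a b)
    (PrimrecRel.forall_mem_list (R := fun b a => p a b)
      (PrimrecPred.comp hp (Primrec.pair Primrec.snd Primrec.fst))) hf Primrec.id

theorem PrimrecPred.sum {p : γ → α ⊕ β → Prop}
    (h₁ : PrimrecPred fun x : γ × α => p x.1 (.inl x.2))
    (h₂ : PrimrecPred fun x : γ × β => p x.1 (.inr x.2)) :
    PrimrecPred fun x : γ × (α ⊕ β) => p x.1 x.2 := by
  classical
  have h₁' := h₁.decide
  have h₂' := h₂.decide
  refine Primrec.primrecPred ?_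
  refine (Primrec.sumCasesOn (f := fun x : γ × (α ⊕ β) => x.2)
    (g := fun x a => decide (p x.1 (.inl a))) (h := fun x b => decide (p x.1 (.inr b)))
    Primrec.snd ?_ ?_).of_eq ?_
  · exact Primrec.comp h₁' (g := fun y : (γ × (α ⊕ β)) × α => (y.1.1, y.2)) (by fun_prop)
  · exact Primrec.comp h₂' (g := fun y : (γ × (α ⊕ β)) × β => (y.1.1, y.2)) (by fun_prop)
  · rintro ⟨x, a | b⟩ <;> rfl

theorem Primrec.finset_sortedList : Primrec (Finset.sortedList : Finset α → List α) := by
  classical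
  let _ : Primcodable {l : List α //
      l.Pairwise (fun a b => Encodable.encode a < Encodable.encode b)} :=
    Primcodable.subtype primrecPred_pairwise_encode_lt
  exact Primrec.subtype_val.comp (Primrec.of_equiv (e := finsetEquivSortedList α))

@[fun_prop]
theorem Primrec.sortedList_comp {f : α → Finset β} (hf : Primrec f) :
    Primrec fun a => (f a).sortedList :=
  Primrec.finset_sortedList.comp hf

theorem PrimrecPred.forall_finset {f : α → Finset β} {p : α → β → Prop} (hf : Primrec f)
    (hp : PrimrecPred fun x : α × β => p x.1 x.2) : PrimrecPred fun a => ∀ b ∈ f a, p a b :=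
  (PrimrecPred.forall_list (f := fun a => (f a).sortedList) (by fun_prop) hp).of_eq fun a => by
    simp

theorem PrimrecPred.exists_finset {f : α → Finset β} {p : α → β → Prop} (hf : Primrec f)
    (hp : PrimrecPred fun x : α × β => p x.1 x.2) : PrimrecPred fun a => ∃ b ∈ f a, p a b :=
  (PrimrecPred.forall_finset (p := fun a b => ¬ p a b) hf hp.not).not.of_eq fun a => by
    push Not; rfl

@[fun_prop]
theorem PrimrecPred.finset_mem {f : α → β} {g : α → Finset β} (hf : Primrec f) (hg : Primrec g) :
    PrimrecPred fun a => f a ∈ g a :=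
  (PrimrecPred.exists_finset (p := fun a b => f a = b) hg (by fun_prop)).of_eq fun a => by simp

theorem PrimrecPred.forall_fin {n : ℕ} {p : α → Fin n → Prop}
    (hp : PrimrecPred fun x : α × Fin n => p x.1 x.2) : PrimrecPred fun a => ∀ i, p a i :=
  (PrimrecPred.forall_list (f := fun _ => List.finRange n) (by fun_prop) hp).of_eq fun a => by
    simp

/-- Inserting an element into a sorted list puts it between the elements with smaller codes and
those with larger codes. -/
theorem Primrec.finset_insert [DecidableEq α] :
    Primrec fun x : α × Finset α => insert x.1 x.2 := by
  classical
  let _ : Primcodable {l : List α //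
      l.Pairwise (fun a b => Encodable.encode a < Encodable.encode b)} :=
    Primcodable.subtype primrecPred_pairwise_encode_lt
  have hlt : PrimrecRel fun b a : α => Encodable.encode b < Encodable.encode a :=
    Primrec.nat_lt.comp (Primrec.encode.comp Primrec.fst) (Primrec.encode.comp Primrec.snd)
  have hgt : PrimrecRel fun b a : α => Encodable.encode a < Encodable.encode b :=
    Primrec.nat_lt.comp (Primrec.encode.comp Primrec.snd) (Primrec.encode.comp Primrec.fst)
  have hs : ∀ x : α × Finset α, x.2.sortedList.Pairwise _ :=
    fun x => (finsetEquivSortedList α x.2).2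
  refine (Primrec.comp (Primrec.of_equiv_symm (e := finsetEquivSortedList α))
    (Primrec.subtype_mk
    (f := fun x : α × Finset α =>
      x.2.sortedList.filter (fun b => Encodable.encode b < Encodable.encode x.1) ++
      x.1 :: x.2.sortedList.filter (fun b => Encodable.encode x.1 < Encodable.encode b))
    (hp := primrecPred_pairwise_encode_lt) (h := ?_) ?_)).of_eq ?_
  · intro x
    refine List.pairwise_append.2 ⟨(hs x).filter _, List.pairwise_cons.2 ⟨?_, (hs x).filter _⟩, ?_⟩
    · intro b hb
      simpa using (List.mem_filter.1 hb).2
    · intro a ha b hb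
      have ha' : Encodable.encode a < Encodable.encode x.1 := by
        simpa using (List.mem_filter.1 ha).2
      rcases List.mem_cons.1 hb with rfl | hb
      · exact ha'
      · exact ha'.trans (by simpa using (List.mem_filter.1 hb).2)
  · refine Primrec.list_append.comp ?_ (Primrec.list_cons.comp Primrec.fst ?_)
    · exact hlt.listFilter.comp (by fun_prop) (by fun_prop)
    · exact hgt.listFilter.comp (by fun_prop) (by fun_prop)
  · rintro ⟨a, s⟩
    ext b
    have he : ∀ l, b ∈ (finsetEquivSortedList α).symm l ↔ b ∈ l.1 := by
      intro l
      simp [finsetEquivSortedList]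
    rw [he]
    simp only [List.mem_append, List.mem_filter, Finset.mem_sortedList, List.mem_cons,
      decide_eq_true_eq, Finset.mem_insert]
    constructor
    · tauto
    · rintro (h | h)
      · exact Or.inr (Or.inl h)
      · rcases lt_trichotomy (Encodable.encode b) (Encodable.encode a) with h' | h' | h'
        · exact Or.inl ⟨h, h'⟩
        · exact Or.inr (Or.inl (Encodable.encode_injective h'))
        · exact Or.inr (Or.inr ⟨h, h'⟩)

@[fun_prop]
theorem Primrec.insert_comp [DecidableEq β] {f : α → β} {g : α → Finset β} (hf : Primrec f)
    (hg : Primrec g) : Primrec fun a => insert (f a) (g a) :=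
  Primrec.finset_insert.comp (hf.pair hg)

@[fun_prop]
theorem Primrec.toFinset_comp [DecidableEq β] {f : α → List β} (hf : Primrec f) :
    Primrec fun a => (f a).toFinset := by
  refine (Primrec.list_foldr (g := fun _ => (∅ : Finset β))
    (h := fun _ (x : β × Finset β) => insert x.1 x.2) hf (by fun_prop) ?_).of_eq ?_
  · unfold Primrec₂
    fun_prop
  · intro a
    induction f a with
    | nil => rfl
    | cons b l ih => simp only [List.foldr_cons, ih, List.toFinset_cons]

theorem Primrec.finset_image [DecidableEq γ] {f : α → Finset β} {g : α → β → γ}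
    (hf : Primrec f) (hg : Primrec fun x : α × β => g x.1 x.2) :
    Primrec fun a => (f a).image (g a) :=
  (Primrec.toFinset_comp (f := fun a => (f a).sortedList.map (g a))
    (Primrec.list_map (by fun_prop) hg)).of_eq fun a => by ext; simp

theorem Primrec.finset_filter {f : α → Finset β} {p : α → β → Prop}
    [∀ a, DecidablePred (p a)] (hf : Primrec f) (hp : PrimrecPred fun x : α × β => p x.1 x.2) :
    Primrec fun a => (f a).filter (p a) := by
  classical
  have h : Primrec₂ fun (l : List β) (a : α) => l.filter fun b => p a b :=
    PrimrecRel.listFilter (R := fun b a => p a b)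
      (PrimrecPred.comp hp (Primrec.pair Primrec.snd Primrec.fst))
  exact (Primrec.toFinset_comp (h.comp (f := fun _ _ => _) (g := fun a => (f a).sortedList)
    (by fun_prop) Primrec.id)).of_eq fun a => by ext; simp

theorem Primrec.finset_biUnion [DecidableEq γ] {f : α → Finset β} {g : α → β → Finset γ}
    (hf : Primrec f) (hg : Primrec fun x : α × β => g x.1 x.2) :
    Primrec fun a => (f a).biUnion (g a) :=
  (Primrec.toFinset_comp (f := fun a => (f a).sortedList.flatMap fun b => (g a b).sortedList)
    (Primrec.list_flatMap (by fun_prop) (Primrec.sortedList_comp hg))).of_eq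
      fun a => by ext; simp

@[fun_prop]
theorem Primrec.finset_union [DecidableEq β] {f g : α → Finset β} (hf : Primrec f)
    (hg : Primrec g) : Primrec fun a => f a ∪ g a :=
  (Primrec.toFinset_comp (f := fun a => (f a).sortedList ++ (g a).sortedList)
    (Primrec.list_append.comp (by fun_prop) (by fun_prop))).of_eq fun a => by ext; simp

@[fun_prop]
theorem Primrec.finset_inter [DecidableEq β] {f g : α → Finset β} (hf : Primrec f)
    (hg : Primrec g) : Primrec fun a => f a ∩ g a :=
  (Primrec.finset_filter (p := fun a b => b ∈ g a) hf (by fun_prop)).of_eq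
    fun a => by ext; simp

@[fun_prop]
theorem Primrec.finset_erase [DecidableEq β] {f : α → Finset β} {g : α → β} (hf : Primrec f)
    (hg : Primrec g) : Primrec fun a => (f a).erase (g a) :=
  (Primrec.finset_filter (p := fun a b => b ≠ g a) hf (by fun_prop)).of_eq
    fun a => by ext; simp [and_comm]

@[fun_prop]
theorem Primrec.finset_product {f : α → Finset β} {g : α → Finset γ} (hf : Primrec f)
    (hg : Primrec g) : Primrec fun a => f a ×ˢ g a := by
  classical
  exact (Primrec.finset_biUnion (g := fun a b => (g a).image fun c => (b, c)) hf
    (Primrec.finset_image (g := fun (x : α × β) c => (x.2, c)) (by fun_prop)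
      (by fun_prop))).of_eq fun a => by ext ⟨b, c⟩; simp

@[fun_prop]
theorem Primrec.finset_range {f : α → ℕ} (hf : Primrec f) :
    Primrec fun a => Finset.range (f a) :=
  (Primrec.toFinset_comp (Primrec.list_range.comp hf)).of_eq fun a => by ext; simp

@[fun_prop]
theorem Primrec.finset_card {f : α → Finset β} (hf : Primrec f) :
    Primrec fun a => (f a).card := by
  classical
  refine (Primrec.list_length.comp (Primrec.sortedList_comp hf)).of_eq fun a => ?_
  rw [← List.toFinset_card_of_nodup (f a).nodup_sortedList]
  congr 1
  ext; simp

theorem Primrec.finset_sum {f : α → Finset β} {g : α → β → ℕ} (hf : Primrec f)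
    (hg : Primrec fun x : α × β => g x.1 x.2) : Primrec fun a => ∑ b ∈ f a, g a b := by
  classical
  refine (Primrec.list_foldr (f := fun a => (f a).sortedList) (g := fun _ => 0)
    (h := fun a (x : β × ℕ) => g a x.1 + x.2) (by fun_prop) (by fun_prop) ?_).of_eq fun a => ?_
  · exact Primrec.add_comp
      (Primrec.comp hg (g := fun y : α × (β × ℕ) => (y.1, y.2.1)) (by fun_prop)) (by fun_prop)
  · have h : (f a) = (f a).sortedList.toFinset := by ext; simp
    conv_rhs => rw [h, List.sum_toFinset _ (f a).nodup_sortedList]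
    induction (f a).sortedList with
    | nil => rfl
    | cons b l ih => simp [ih]

@[fun_prop]
theorem Primrec.finset_powerset {f : α → Finset β} (hf : Primrec f) :
    Primrec fun a => (f a).powerset := by
  classical
  refine (Primrec.list_foldr (f := fun a => (f a).sortedList)
    (g := fun _ => ({∅} : Finset (Finset β)))
    (h := fun _ (x : β × Finset (Finset β)) => x.2 ∪ x.2.image (insert x.1))
    (by fun_prop) (by fun_prop) ?_).of_eq fun a => ?_
  · refine Primrec.finset_union (by fun_prop) (Primrec.finset_image (by fun_prop) (by fun_prop))
  · have h : (f a) = (f a).sortedList.toFinset := by ext; simp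
    conv_rhs => rw [h]
    induction (f a).sortedList with
    | nil => rfl
    | cons b l ih => rw [List.foldr_cons, ih, List.toFinset_cons, Finset.powerset_insert]

/-- An unbounded search for an object related to a given one, where one always exists, is
computable. -/
theorem PrimrecPred.exists_computable {p : α → β → Prop}
    (hp : PrimrecPred fun x : α × β => p x.1 x.2) (h : ∀ a, ∃ b, p a b) :
    ∃ f : α → β, Computable f ∧ ∀ a, p a (f a) := by
  classical
  let g : α → ℕ → Option β := fun a n => (Encodable.decode n).bind (Option.guard (p a))
  have hg : Computable₂ g := by
    refine Primrec.to_comp (Primrec.option_bind (Primrec.decode.comp Primrec.snd) ?_)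
    exact Primrec.option_guard (p := fun (x : (α × ℕ) × β) b => p x.1.1 b) (f := fun x => x.2)
      (PrimrecPred.comp hp (f := fun y : ((α × ℕ) × β) × β => (y.1.1.1, y.2)) (by fun_prop))
      Primrec.snd
  have hd : ∀ a, (Nat.rfindOpt (g a)).Dom := fun a => by
    obtain ⟨b, hb⟩ := h a
    exact Nat.rfindOpt_dom.2 ⟨Encodable.encode b, b, by simp [g, hb, Option.guard]⟩
  refine ⟨fun a => (Nat.rfindOpt (g a)).get (hd a), ?_, fun a => ?_⟩
  · exact (Partrec.rfindOpt hg).of_eq fun a => (Part.some_get (hd a)).symm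
  · obtain ⟨n, hn⟩ := Nat.rfindOpt_spec (Part.get_mem (hd a))
    obtain ⟨b, -, hb⟩ := Option.mem_bind_iff.1 hn
    simp [Option.guard] at hb
    have hb' := hb.1
    rwa [hb.2] at hb'

@[fun_prop]
theorem PrimrecPred.enat_coe_le {f : α → ℕ} {g : α → ℕ∞} (hf : Primrec f) (hg : Primrec g) :
    PrimrecPred fun a => (f a : ℕ∞) ≤ g a := by
  classical
  have hg' : Primrec (β := Option ℕ) g := hg
  refine Primrec.primrecPred ((Primrec.option_casesOn (o := (g : α → Option ℕ))
    (f := fun _ => true) (g := fun a n => decide (f a ≤ n)) hg' (by fun_prop) ?_).of_eq ?_)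
  · exact PrimrecPred.decide (p := fun x : α × ℕ => f x.1 ≤ x.2) (by fun_prop)
  · intro a
    cases hga : g a using ENat.recTopCoe with
    | top => simp; rfl
    | coe n =>
      have h : ((f a : ℕ∞) ≤ n) ↔ f a ≤ n := Nat.cast_le
      simp only [h]
      rfl

@[fun_prop]
theorem PrimrecPred.enat_le_coe {f : α → ℕ∞} {g : α → ℕ} (hf : Primrec f) (hg : Primrec g) :
    PrimrecPred fun a => f a ≤ (g a : ℕ∞) :=
  PrimrecPred.of_eq (p := fun a => ¬ ((g a + 1 : ℕ) : ℕ∞) ≤ f a) (by fun_prop) fun a => by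
    rw [Nat.cast_add, Nat.cast_one, ENat.add_one_le_iff (ENat.natCast_ne_top _), not_lt]

end Primrec

namespace Microservice

/-! ### The predicates of the deployment problem are primitive recursive -/

section Primrec

variable {α β γ : Type*} [Primcodable α] [Primcodable β] [Primcodable γ] {k : ℕ}

@[fun_prop]
theorem primrec_dom [DecidableEq β] {f : α → Finset (β × γ)} (hf : Primrec f) :
    Primrec fun a => dom (f a) :=
  Primrec.finset_image hf (by fun_prop)

@[fun_prop]
theorem primrec_ran [DecidableEq γ] {f : α → Finset (β × γ)} (hf : Primrec f) :
    Primrec fun a => ran (f a) :=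
  Primrec.finset_image hf (by fun_prop)

@[fun_prop]
theorem primrecPred_functional {f : α → Finset (β × γ)} (hf : Primrec f) :
    PrimrecPred fun a => Functional (f a) :=
  (PrimrecPred.forall_finset (p := fun a x => ∀ y ∈ f a, x.1 = y.1 → x.2 = y.2) hf
    (PrimrecPred.forall_finset (by fun_prop) (by fun_prop))).of_eq fun a =>
      ⟨fun h b c c' h₁ h₂ => h _ h₁ _ h₂ rfl, fun h x hx y hy e => h x.1 x.2 y.2 hx (e ▸ hy)⟩

@[fun_prop]
theorem primrec_prov {f : α → MType k} (hf : Primrec f) : Primrec fun a => (f a).prov :=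
  (Primrec.fst.comp Primrec.of_equiv).comp (f := fun T => (MType.equivProd k T).1) hf

@[fun_prop]
theorem primrec_reqS {f : α → MType k} (hf : Primrec f) : Primrec fun a => (f a).reqS :=
  ((Primrec.fst.comp Primrec.snd).comp Primrec.of_equiv).comp
    (f := fun T => (MType.equivProd k T).2.1) hf

@[fun_prop]
theorem primrec_reqW {f : α → MType k} (hf : Primrec f) : Primrec fun a => (f a).reqW :=
  Primrec.comp (f := fun x : _ × _ × _ × _ × _ => x.2.2.1) (by fun_prop)
    ((Primrec.of_equiv (e := MType.equivProd k)).comp hf)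

@[fun_prop]
theorem primrec_conf {f : α → MType k} (hf : Primrec f) : Primrec fun a => (f a).conf :=
  Primrec.comp (f := fun x : _ × _ × _ × _ × _ => x.2.2.2.1) (by fun_prop)
    ((Primrec.of_equiv (e := MType.equivProd k)).comp hf)

@[fun_prop]
theorem primrec_type_res {f : α → MType k} {g : α → Fin k} (hf : Primrec f) (hg : Primrec g) :
    Primrec fun a => (f a).res (g a) :=
  Primrec.fin_app.comp (Primrec.comp (f := fun x : _ × _ × _ × _ × _ => x.2.2.2.2) (by fun_prop)
    ((Primrec.of_equiv (e := MType.equivProd k)).comp hf)) hg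

@[fun_prop]
theorem primrec_node_res {f : α → Node k} {g : α → Fin k} (hf : Primrec f) (hg : Primrec g) :
    Primrec fun a => (f a).res (g a) :=
  Primrec.fin_app.comp (Primrec.comp (f := fun x : _ × _ × _ => x.2.1) (by fun_prop)
    ((Primrec.of_equiv (e := Node.equivProd k)).comp hf)) hg

@[fun_prop]
theorem primrec_node_cost {f : α → Node k} (hf : Primrec f) : Primrec fun a => (f a).cost :=
  Primrec.comp (f := fun x : _ × _ × _ => x.2.2) (by fun_prop)
    ((Primrec.of_equiv (e := Node.equivProd k)).comp hf)

@[fun_prop]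
theorem primrec_Z {f : α → Config k} (hf : Primrec f) : Primrec fun a => (f a).Z :=
  Primrec.comp (f := fun x : _ × _ × _ × _ => x.1) (by fun_prop)
    ((Primrec.of_equiv (e := Config.equivProd k)).comp hf)

@[fun_prop]
theorem primrec_T {f : α → Config k} (hf : Primrec f) : Primrec fun a => (f a).T :=
  Primrec.comp (f := fun x : _ × _ × _ × _ => x.2.1) (by fun_prop)
    ((Primrec.of_equiv (e := Config.equivProd k)).comp hf)

@[fun_prop]
theorem primrec_N {f : α → Config k} (hf : Primrec f) : Primrec fun a => (f a).N :=
  Primrec.comp (f := fun x : _ × _ × _ × _ => x.2.2.1) (by fun_prop)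
    ((Primrec.of_equiv (e := Config.equivProd k)).comp hf)

@[fun_prop]
theorem primrec_B {f : α → Config k} (hf : Primrec f) : Primrec fun a => (f a).B :=
  Primrec.comp (f := fun x : _ × _ × _ × _ => x.2.2.2) (by fun_prop)
    ((Primrec.of_equiv (e := Config.equivProd k)).comp hf)

@[fun_prop]
theorem primrec_config {Z : α → Finset ℕ} {T : α → Finset (ℕ × MType k)}
    {N : α → Finset (ℕ × Node k)} {B : α → Finset (ℕ × ℕ × ℕ)} (hZ : Primrec Z) (hT : Primrec T)
    (hN : Primrec N) (hB : Primrec B) : Primrec fun a => (⟨Z a, T a, N a, B a⟩ : Config k) :=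
  (Primrec.of_equiv_symm (e := Config.equivProd k)).comp (hZ.pair (hT.pair (hN.pair hB)))

@[fun_prop]
theorem primrec_U {f : α → Input k} (hf : Primrec f) : Primrec fun a => (f a).U :=
  Primrec.comp (f := fun x : _ × _ × _ × _ => x.1) (by fun_prop)
    ((Primrec.of_equiv (e := Input.equivProd k)).comp hf)

@[fun_prop]
theorem primrec_O {f : α → Input k} (hf : Primrec f) : Primrec fun a => (f a).O :=
  Primrec.comp (f := fun x : _ × _ × _ × _ => x.2.1) (by fun_prop)
    ((Primrec.of_equiv (e := Input.equivProd k)).comp hf)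

@[fun_prop]
theorem primrec_C₀ {f : α → Input k} (hf : Primrec f) : Primrec fun a => (f a).C₀ :=
  Primrec.comp (f := fun x : _ × _ × _ × _ => x.2.2.1) (by fun_prop)
    ((Primrec.of_equiv (e := Input.equivProd k)).comp hf)

@[fun_prop]
theorem primrec_target {f : α → Input k} (hf : Primrec f) : Primrec fun a => (f a).target :=
  Primrec.comp (f := fun x : _ × _ × _ × _ => x.2.2.2) (by fun_prop)
    ((Primrec.of_equiv (e := Input.equivProd k)).comp hf)

@[fun_prop]
theorem primrecPred_disjoint [DecidableEq β] {f g : α → Finset β} (hf : Primrec f)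
    (hg : Primrec g) : PrimrecPred fun a => Disjoint (f a) (g a) :=
  (PrimrecPred.forall_finset (p := fun a b => b ∉ g a) hf (by fun_prop)).of_eq fun a =>
    Finset.disjoint_left.symm

@[fun_prop]
theorem primrecPred_isType {f : α → MType k} (hf : Primrec f) :
    PrimrecPred fun a => (f a).IsType := by
  have h₁ : PrimrecPred fun a => ∀ x ∈ (f a).prov, x.2 ≠ 0 :=
    PrimrecPred.forall_finset (by fun_prop) (by fun_prop)
  have h₂ : PrimrecPred fun a => ∀ x ∈ (f a).reqS, x.2 ≠ 0 :=
    PrimrecPred.forall_finset (by fun_prop) (by fun_prop)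
  have h : PrimrecPred fun a => Functional (f a).prov ∧ (∀ x ∈ (f a).prov, x.2 ≠ 0) ∧
      Functional (f a).reqS ∧ (∀ x ∈ (f a).reqS, x.2 ≠ 0) ∧ Functional (f a).reqW ∧
      Disjoint (dom (f a).reqS) (dom (f a).reqW) ∧ Disjoint (dom (f a).reqS) (f a).conf ∧
      Disjoint (dom (f a).reqW) (f a).conf := by
    fun_prop
  refine h.of_eq fun a => ⟨fun ⟨h₁, h₂, h₃, h₄, h₅, h₆, h₇, h₈⟩ =>
    ⟨h₁, fun p n h => h₂ (p, n) h, h₃, fun p n h => h₄ (p, n) h, h₅, h₆, h₇, h₈⟩,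
    fun h => ⟨h.1, fun x hx => h.2 _ _ hx, h.3, fun x hx => h.4 _ _ hx, h.5, h.6, h.7, h.8⟩⟩

theorem primrecPred_exists_mem_pair {f : α → Finset (β × γ)} {g : α → β} {p : α → γ → Prop}
    (hf : Primrec f) (hg : Primrec g) (hp : PrimrecPred fun x : α × γ => p x.1 x.2) :
    PrimrecPred fun a => ∃ c, (g a, c) ∈ f a ∧ p a c :=
  (PrimrecPred.exists_finset (p := fun a x => x.1 = g a ∧ p a x.2) hf
    (PrimrecPred.and (by fun_prop) (PrimrecPred.comp hp
      (f := fun x : α × β × γ => (x.1, x.2.2)) (by fun_prop)))).of_eq fun a =>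
    ⟨fun ⟨x, hx, e, h⟩ => ⟨x.2, e ▸ hx, h⟩, fun ⟨c, hc, h⟩ => ⟨_, hc, rfl, h⟩⟩

theorem primrecPred_forall_mem_pair {f : α → Finset (β × γ)} {p : α → β → γ → Prop}
    (hf : Primrec f) (hp : PrimrecPred fun x : α × β × γ => p x.1 x.2.1 x.2.2) :
    PrimrecPred fun a => ∀ b c, (b, c) ∈ f a → p a b c :=
  (PrimrecPred.forall_finset (p := fun a x => p a x.1 x.2) hf hp).of_eq fun _ =>
    ⟨fun h _ _ hx => h _ hx, fun h _ hx => h _ _ hx⟩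

@[fun_prop]
theorem primrecPred_isConfig {f : α → Config k} (hf : Primrec f) :
    PrimrecPred fun a => (f a).IsConfig := by
  have h₁ : PrimrecPred fun a => ∀ z T, (z, T) ∈ (f a).T → T.IsType :=
    primrecPred_forall_mem_pair (p := fun _ _ (T : MType k) => T.IsType) (by fun_prop) (by fun_prop)
  have h₂ : PrimrecPred fun a => ∀ x ∈ (f a).B, x.2.1 ≠ x.2.2 ∧
      ∃ T₁, (x.2.1, T₁) ∈ (f a).T ∧ ∃ T₂, (x.2.2, T₂) ∈ (f a).T ∧
        x.1 ∈ dom T₁.reqS ∪ dom T₁.reqW ∧ x.1 ∈ dom T₂.prov := by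
    refine PrimrecPred.forall_finset (by fun_prop) (PrimrecPred.and (by fun_prop) ?_)
    refine primrecPred_exists_mem_pair (by fun_prop) (by fun_prop) ?_
    exact primrecPred_exists_mem_pair (by fun_prop) (by fun_prop) (by fun_prop)
  have h : PrimrecPred fun a => Functional (f a).T ∧ dom (f a).T = (f a).Z ∧
      (∀ z T, (z, T) ∈ (f a).T → T.IsType) ∧ Functional (f a).N ∧ dom (f a).N = (f a).Z ∧
      (∀ x ∈ (f a).B, x.2.1 ≠ x.2.2 ∧
      ∃ T₁, (x.2.1, T₁) ∈ (f a).T ∧ ∃ T₂, (x.2.2, T₂) ∈ (f a).T ∧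
        x.1 ∈ dom T₁.reqS ∪ dom T₁.reqW ∧ x.1 ∈ dom T₂.prov) :=
    PrimrecPred.and (by fun_prop) (by fun_prop)
  refine h.of_eq fun a => ⟨fun ⟨h₁, h₂, h₃, h₄, h₅, h₆⟩ => ⟨h₁, h₂, h₃, h₄, h₅, fun p z₁ z₂ h =>
    ?_⟩, fun h => ⟨h.1, h.2, h.3, h.4, h.5, fun x hx => ?_⟩⟩
  · obtain ⟨h, T₁, hT₁, T₂, hT₂, h'⟩ := h₆ _ h
    exact ⟨h, T₁, T₂, hT₁, hT₂, h'⟩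
  · obtain ⟨h, T₁, T₂, hT₁, hT₂, h'⟩ := h.6 _ _ _ hx
    exact ⟨h, T₁, hT₁, T₂, hT₂, h'⟩

open Classical in
/-- The providers other than `z` to which `z` is bound on `p`. -/
noncomputable def Config.providers (C : Config k) (p z : ℕ) : Finset ℕ :=
  (C.Z.erase z).filter fun z' => (p, z, z') ∈ C.B ∧ ∃ T', (z', T') ∈ C.T ∧ p ∈ dom T'.prov

open Classical in
/-- The requirers other than `z` that are bound to `z` on `p`. -/
noncomputable def Config.requirers (C : Config k) (p z : ℕ) : Finset ℕ :=
  (C.Z.erase z).filter fun z' =>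
    (p, z', z) ∈ C.B ∧ ∃ T', (z', T') ∈ C.T ∧ p ∈ dom T'.reqS ∪ dom T'.reqW

theorem exists_subset_card_eq_iff {A : Finset ℕ} {P : ℕ → Prop} [DecidablePred P] {n : ℕ} :
    (∃ S ⊆ A, S.card = n ∧ ∀ x ∈ S, P x) ↔ n ≤ (A.filter P).card := by
  rw [Finset.le_card_iff_exists_subset_card]
  refine exists_congr fun S => ⟨fun ⟨h₁, h₂, h₃⟩ =>
    ⟨fun x hx => Finset.mem_filter.2 ⟨h₁ hx, h₃ x hx⟩, h₂⟩, fun ⟨h₁, h₂⟩ =>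
    ⟨fun x hx => (Finset.mem_filter.1 (h₁ hx)).1, h₂, fun x hx => (Finset.mem_filter.1 (h₁ hx)).2⟩⟩

theorem Config.hasProviders_iff {C : Config k} {p z n : ℕ} :
    C.HasProviders p z n ↔ n ≤ (C.providers p z).card := by
  classical
  exact exists_subset_card_eq_iff

theorem Config.hasRequirers_iff {C : Config k} {p z n : ℕ} :
    C.HasRequirers p z n ↔ n ≤ (C.requirers p z).card := by
  classical
  exact exists_subset_card_eq_iff

theorem Config.not_hasRequirers_iff {C : Config k} {p z : ℕ} {n : ℕ∞} :
    (¬ ∃ m : ℕ, n < m ∧ C.HasRequirers p z m) ↔ ((C.requirers p z).card : ℕ∞) ≤ n := by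
  simp only [hasRequirers_iff, not_exists, not_and]
  refine ⟨fun h => not_lt.1 fun h' => h _ h' le_rfl, fun h m hm hm' => ?_⟩
  exact absurd (hm.trans_le (Nat.cast_le.2 hm')) (not_lt.2 h)

@[fun_prop]
theorem primrec_providers {f : α → Config k} {p z : α → ℕ} (hf : Primrec f) (hp : Primrec p)
    (hz : Primrec z) : Primrec fun a => (f a).providers (p a) (z a) := by
  classical
  exact Primrec.finset_filter (by fun_prop) (PrimrecPred.and (by fun_prop)
    (primrecPred_exists_mem_pair (by fun_prop) (by fun_prop) (by fun_prop)))

@[fun_prop]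
theorem primrec_requirers {f : α → Config k} {p z : α → ℕ} (hf : Primrec f) (hp : Primrec p)
    (hz : Primrec z) : Primrec fun a => (f a).requirers (p a) (z a) := by
  classical
  exact Primrec.finset_filter (by fun_prop) (PrimrecPred.and (by fun_prop)
    (primrecPred_exists_mem_pair (by fun_prop) (by fun_prop) (by fun_prop)))

@[fun_prop]
theorem primrecPred_hasProviders {f : α → Config k} {p z n : α → ℕ} (hf : Primrec f)
    (hp : Primrec p) (hz : Primrec z) (hn : Primrec n) :
    PrimrecPred fun a => (f a).HasProviders (p a) (z a) (n a) :=
  PrimrecPred.of_eq (p := fun a => n a ≤ ((f a).providers (p a) (z a)).card) (by fun_prop)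
    fun _ => Config.hasProviders_iff.symm

@[fun_prop]
theorem primrecPred_provCorrect {f : α → Config k} (hf : Primrec f) :
    PrimrecPred fun a => (f a).ProvCorrect := by
  have h₁ : PrimrecPred fun a => ∀ o ∈ ran (f a).N, ∀ r : Fin k,
      ∑ x ∈ (f a).T with (x.1, o) ∈ (f a).N, x.2.res r ≤ o.res r := by
    refine PrimrecPred.forall_finset (by fun_prop) (PrimrecPred.forall_fin ?_)
    refine PrimrecPred.nat_le (Primrec.finset_sum ?_ (by fun_prop)) (by fun_prop)
    exact Primrec.finset_filter (by fun_prop) (by fun_prop)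
  have h₂ : PrimrecPred fun a => ∀ z T, (z, T) ∈ (f a).T → ∀ p n, (p, n) ∈ T.reqS →
      (f a).HasProviders p z n :=
    primrecPred_forall_mem_pair (p := fun a z (T : MType k) => ∀ p n, (p, n) ∈ T.reqS →
      (f a).HasProviders p z n) (by fun_prop) (primrecPred_forall_mem_pair
        (p := fun (x : α × ℕ × MType k) p n => (f x.1).HasProviders p x.2.1 n)
        (by fun_prop) (by fun_prop))
  have h₃ : PrimrecPred fun a => ∀ z T, (z, T) ∈ (f a).T → ∀ p n, (p, n) ∈ T.prov →
      (((f a).requirers p z).card : ℕ∞) ≤ n :=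
    primrecPred_forall_mem_pair (p := fun a z (T : MType k) => ∀ p n, (p, n) ∈ T.prov →
      (((f a).requirers p z).card : ℕ∞) ≤ n) (by fun_prop) (primrecPred_forall_mem_pair
        (p := fun (x : α × ℕ × MType k) p n => (((f x.1).requirers p x.2.1).card : ℕ∞) ≤ n)
        (by fun_prop) (by fun_prop))
  refine ((primrecPred_isConfig hf).and (h₁.and (h₂.and h₃))).of_eq fun a =>
    ⟨fun ⟨h₁, h₂, h₃, h₄⟩ => ⟨h₁, h₂, h₃, ?_⟩, fun h => ⟨h.1, h.2, h.3, ?_⟩⟩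
  · intro z T hz p n hp
    exact Config.not_hasRequirers_iff.2 (h₄ z T hz p n hp)
  · intro z T hz p n hp
    exact Config.not_hasRequirers_iff.1 (h.4 z T hz p n hp)

@[fun_prop]
theorem primrecPred_correct {f : α → Config k} (hf : Primrec f) :
    PrimrecPred fun a => (f a).Correct := by
  have h₂ : PrimrecPred fun a => ∀ z T, (z, T) ∈ (f a).T → ∀ p n, (p, n) ∈ T.reqW →
      (f a).HasProviders p z n :=
    primrecPred_forall_mem_pair (p := fun a z (T : MType k) => ∀ p n, (p, n) ∈ T.reqW →
      (f a).HasProviders p z n) (by fun_prop) (primrecPred_forall_mem_pair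
        (p := fun (x : α × ℕ × MType k) p n => (f x.1).HasProviders p x.2.1 n)
        (by fun_prop) (by fun_prop))
  have h₃ : PrimrecPred fun a => ∀ z T, (z, T) ∈ (f a).T → ∀ p ∈ T.conf,
      ∀ z' T', (z', T') ∈ (f a).T → z' ≠ z → p ∉ dom T'.prov := by
    refine primrecPred_forall_mem_pair (p := fun a z (T : MType k) => ∀ p ∈ T.conf,
      ∀ z' T', (z', T') ∈ (f a).T → z' ≠ z → p ∉ dom T'.prov) (by fun_prop) ?_
    refine PrimrecPred.forall_finset (by fun_prop) ?_
    exact primrecPred_forall_mem_pair (p := fun (x : (α × ℕ × MType k) × ℕ) z' (T' : MType k) =>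
      z' ≠ x.1.2.1 → x.2 ∉ dom T'.prov) (by fun_prop) (by fun_prop)
  exact ((primrecPred_provCorrect hf).and (h₂.and h₃)).of_eq fun a =>
    ⟨fun ⟨h₁, h₂, h₃⟩ => ⟨h₁, h₂, h₃⟩, fun h => ⟨h.1, h.2, h.3⟩⟩

@[fun_prop]
theorem primrec_cost {f : α → Config k} (hf : Primrec f) : Primrec fun a => (f a).cost :=
  Primrec.finset_sum (by fun_prop) (by fun_prop)

/-- The configuration left by the action `del z`. -/
def Config.del (C : Config k) (z : ℕ) : Config k :=
  ⟨C.Z.erase z, C.T.filter (fun x => z ≠ x.1), C.N.filter (fun x => z ≠ x.1),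
    C.B.filter (fun b => z ≠ b.2.1 ∧ z ≠ b.2.2)⟩

@[fun_prop]
theorem primrec_del {f : α → Config k} {z : α → ℕ} (hf : Primrec f) (hz : Primrec z) :
    Primrec fun a => (f a).del (z a) :=
  primrec_config (by fun_prop) (Primrec.finset_filter (by fun_prop) (by fun_prop))
    (Primrec.finset_filter (by fun_prop) (by fun_prop))
    (Primrec.finset_filter (by fun_prop) (by fun_prop))

@[fun_prop]
theorem primrecPred_weakPort {f : α → Config k} {p z₁ z₂ : α → ℕ} (hf : Primrec f)
    (hp : Primrec p) (hz₁ : Primrec z₁) (hz₂ : Primrec z₂) :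
    PrimrecPred fun a => (f a).WeakPort (p a) (z₁ a) (z₂ a) := by
  have h : PrimrecPred fun a => ∃ T₁, (z₁ a, T₁) ∈ (f a).T ∧ ∃ T₂, (z₂ a, T₂) ∈ (f a).T ∧
      p a ∈ dom T₁.reqW ∧ p a ∈ dom T₂.prov :=
    primrecPred_exists_mem_pair (by fun_prop) (by fun_prop)
      (primrecPred_exists_mem_pair (by fun_prop) (by fun_prop) (by fun_prop))
  exact h.of_eq fun a => ⟨fun ⟨T₁, h₁, T₂, h₂, h⟩ => ⟨T₁, T₂, h₁, h₂, h⟩,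
    fun ⟨T₁, T₂, h₁, h₂, h⟩ => ⟨T₁, h₁, T₂, h₂, h⟩⟩

theorem primrecPred_step {f g : α → Config k} {a : α → Action k} (hf : Primrec f)
    (ha : Primrec a) (hg : Primrec g) : PrimrecPred fun x => Step (f x) (a x) (g x) := by
  have h : PrimrecPred fun x : (Config k × Config k) ×
      (((ℕ × ℕ × ℕ) ⊕ (ℕ × ℕ × ℕ)) ⊕ ((ℕ × MType k × Node k × Finset (ℕ × Finset ℕ)) ⊕ ℕ)) =>
      Step x.1.1 ((Action.equivSum k).symm x.2) x.1.2 := by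
    refine PrimrecPred.sum (p := fun (x : Config k × Config k) y =>
      Step x.1 ((Action.equivSum k).symm y) x.2)
      (PrimrecPred.sum (p := fun (x : Config k × Config k) y =>
        Step x.1 ((Action.equivSum k).symm (.inl y)) x.2) ?_ ?_)
      (PrimrecPred.sum (p := fun (x : Config k × Config k) y =>
        Step x.1 ((Action.equivSum k).symm (.inr y)) x.2) ?_ ?_)
    · simp only [Action.equivSum, Equiv.coe_fn_symm_mk, Step, Action.IsAction]
      fun_prop
    · simp only [Action.equivSum, Equiv.coe_fn_symm_mk, Step, Action.IsAction]
      fun_prop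
    · simp only [Action.equivSum, Equiv.coe_fn_symm_mk, Step, Action.IsAction]
      refine PrimrecPred.and ?_ (PrimrecPred.and (by fun_prop) (PrimrecPred.and ?_ ?_))
      · refine PrimrecPred.and (by fun_prop) (PrimrecPred.and (by fun_prop)
          (PrimrecPred.and (by fun_prop) (PrimrecPred.and ?_ ?_)))
        · exact primrecPred_forall_mem_pair (p := fun (x : (Config k × Config k) × ℕ × MType k ×
            Node k × Finset (ℕ × Finset ℕ)) _ S => x.2.1 ∉ S) (by fun_prop) (by fun_prop)
        · refine PrimrecPred.of_eq (p := fun x : (Config k × Config k) × ℕ × MType k ×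
            Node k × Finset (ℕ × Finset ℕ) => ∀ p S, (p, S) ∈ x.2.2.2.2 →
              ∀ y ∈ x.2.2.1.reqS, y.1 = p → y.2 ≤ S.card) ?_ ?_
          · exact primrecPred_forall_mem_pair (p := fun (x : (Config k × Config k) × ℕ × MType k ×
              Node k × Finset (ℕ × Finset ℕ)) p (S : Finset ℕ) =>
                ∀ y ∈ x.2.2.1.reqS, y.1 = p → y.2 ≤ S.card) (by fun_prop)
              (PrimrecPred.forall_finset (by fun_prop) (by fun_prop))
          · exact fun x => ⟨fun h p S n h₁ h₂ => h p S h₁ _ h₂ rfl,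
              fun h p S h₁ y hy e => h p S y.2 h₁ (e ▸ hy)⟩
      · exact primrecPred_forall_mem_pair (p := fun (x : (Config k × Config k) × ℕ × MType k ×
            Node k × Finset (ℕ × Finset ℕ)) p S =>
            ∀ z' ∈ S, ∃ T', (z', T') ∈ x.1.1.T ∧ p ∈ dom T'.prov) (by fun_prop)
          (PrimrecPred.forall_finset (by fun_prop)
            (primrecPred_exists_mem_pair (by fun_prop) (by fun_prop) (by fun_prop)))
      · refine PrimrecPred.eq (by fun_prop) (primrec_config (by fun_prop) (by fun_prop)
          (by fun_prop) (Primrec.finset_union (by fun_prop) ?_))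
        exact Primrec.finset_biUnion (by fun_prop)
          (Primrec.finset_image (by fun_prop) (by fun_prop))
    · simp only [Action.equivSum, Equiv.coe_fn_symm_mk, Step, Action.IsAction]
      exact PrimrecPred.and (by fun_prop)
        (PrimrecPred.eq (by fun_prop) (primrec_del (by fun_prop) (by fun_prop)))
  exact (PrimrecPred.comp h (f := fun x => ((f x, g x), Action.equivSum k (a x)))
    ((hf.pair hg).pair (Primrec.of_equiv.comp ha))).of_eq fun x => by simp

end Primrec

end Microservice

/-! ### Zero-sum subsets of large families of bounded integer vectors -/

section ZeroSum

variable {ι : Type*}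

/-- If no positive value occurs often, then there are few positive values, and the bound on the sum
limits the number of negative values. -/
theorem card_le_of_forall_zero_sum_aux {s : Finset ι} {x : ι → ℤ} {V S : ℕ}
    (hx : ∀ i ∈ s, |x i| ≤ V) (hS : |∑ i ∈ s, x i| ≤ S) (h0 : ∀ i ∈ s, x i ≠ 0)
    (hpos : ∀ u : ℤ, 0 < u → u ≤ V → (s.filter fun i => x i = u).card ≤ V) :
    s.card ≤ V * V * V + V * V + S := by
  have h₁ : (s.filter fun i => 0 < x i).card ≤ V * V := by
    have := Finset.card_le_mul_card_image_of_maps_to (s := s.filter fun i => 0 < x i) (f := x)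
      (t := Finset.Icc (1 : ℤ) V) (fun i hi => ?_) V (fun u hu => ?_)
    · simpa using this
    · rw [Finset.mem_filter] at hi
      exact Finset.mem_Icc.2 ⟨hi.2, (abs_le.1 (hx i hi.1)).2⟩
    · rw [Finset.mem_Icc] at hu
      refine le_trans (Finset.card_le_card ?_) (hpos u hu.1 hu.2)
      intro i hi
      simp only [Finset.mem_filter] at hi ⊢
      exact ⟨hi.1.1, hi.2⟩
  have h₂ := Finset.card_filter_add_card_filter_not (s := s) (fun i => 0 < x i)
  have h₃ := Finset.sum_filter_add_sum_filter_not s (fun i => 0 < x i) x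
  have h₄ : ∑ i ∈ s with 0 < x i, x i ≤ (s.filter fun i => 0 < x i).card * (V : ℤ) := by
    rw [← nsmul_eq_mul]
    exact Finset.sum_le_card_nsmul _ _ _ fun i hi =>
      (abs_le.1 (hx i (Finset.mem_filter.1 hi).1)).2
  have h₅ : ∑ i ∈ s with ¬ 0 < x i, x i ≤ (s.filter fun i => ¬ 0 < x i).card * (-1 : ℤ) := by
    rw [← nsmul_eq_mul]
    refine Finset.sum_le_card_nsmul _ _ _ fun i hi => ?_
    have := h0 i (Finset.mem_filter.1 hi).1
    have := (Finset.mem_filter.1 hi).2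
    omega
  have h₆ := (abs_le.1 hS).1
  have h₇ : ((s.filter fun i => 0 < x i).card : ℤ) * V ≤ V * V * V := by
    have : ((s.filter fun i => 0 < x i).card : ℤ) ≤ V * V := by exact_mod_cast h₁
    exact mul_le_mul_of_nonneg_right this (by positivity)
  zify at h₁ h₂ ⊢
  linarith

variable [DecidableEq ι]

/-- A family without short zero-sum subfamilies is small: if some positive value `u` and some
negative value `-w` both occur often, then `w` copies of `u` and `u` copies of `-w` have sum
zero. -/
theorem card_le_of_forall_zero_sum {s : Finset ι} {x : ι → ℤ} {V S : ℕ}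
    (hx : ∀ i ∈ s, |x i| ≤ V) (hS : |∑ i ∈ s, x i| ≤ S)
    (h : ∀ t ⊆ s, t.Nonempty → t.card ≤ 2 * V + 1 → ∑ i ∈ t, x i ≠ 0) :
    s.card ≤ V * V * V + V * V + S := by
  have h0 : ∀ i ∈ s, x i ≠ 0 := fun i hi => by
    simpa using h {i} (by simpa using hi) (by simp) (by simp)
  by_cases hpos : ∀ u : ℤ, 0 < u → u ≤ V → (s.filter fun i => x i = u).card ≤ V
  · exact card_le_of_forall_zero_sum_aux hx hS h0 hpos
  by_cases hneg : ∀ u : ℤ, 0 < u → u ≤ V → (s.filter fun i => (-x) i = u).card ≤ V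
  · exact card_le_of_forall_zero_sum_aux (x := -x) (by simpa using hx) (by simpa using hS)
      (by simpa using h0) hneg
  push Not at hpos hneg
  obtain ⟨u, hu, huV, hu'⟩ := hpos
  obtain ⟨w, hw, hwV, hw'⟩ := hneg
  lift u to ℕ using hu.le
  lift w to ℕ using hw.le
  obtain ⟨A, hA, hAc⟩ := Finset.exists_subset_card_eq
    (show w ≤ (s.filter fun i => x i = u).card by omega)
  obtain ⟨B, hB, hBc⟩ := Finset.exists_subset_card_eq
    (show u ≤ (s.filter fun i => (-x) i = w).card by omega)
  have hAx : ∀ i ∈ A, x i = u := fun i hi => (Finset.mem_filter.1 (hA hi)).2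
  have hBx : ∀ i ∈ B, x i = -w := fun i hi => by
    have := (Finset.mem_filter.1 (hB hi)).2
    simp only [Pi.neg_apply] at this
    omega
  have hd : Disjoint A B := Finset.disjoint_left.2 fun i hi hi' => by
    have := hAx i hi
    have := hBx i hi'
    omega
  refine absurd ?_ (h (A ∪ B) ?_ ?_ ?_)
  · rw [Finset.sum_union hd, Finset.sum_congr rfl hAx, Finset.sum_congr rfl hBx]
    simp [hAc, hBc, mul_comm]
  · exact Finset.union_subset (hA.trans (Finset.filter_subset _ _))
      (hB.trans (Finset.filter_subset _ _))
  · refine Finset.card_pos.1 ?_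
    rw [Finset.card_union_of_disjoint hd]
    omega
  · rw [Finset.card_union_of_disjoint hd]
    omega

/-- Short zero-sum subsets can be split off until few elements are left. -/
theorem exists_disjoint_zero_sum {V S : ℕ} {x : ι → ℤ} (s : Finset ι)
    (hx : ∀ i ∈ s, |x i| ≤ V) (hS : |∑ i ∈ s, x i| ≤ S) :
    ∃ G : Finset (Finset ι), (G : Set (Finset ι)).PairwiseDisjoint id ∧
      (∀ g ∈ G, g ⊆ s ∧ g.Nonempty ∧ g.card ≤ 2 * V + 1 ∧ ∑ i ∈ g, x i = 0) ∧
      (s \ G.biUnion id).card ≤ V * V * V + V * V + S := by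
  induction s using Finset.strongInduction with
  | H s ih =>
    by_cases h : ∀ t ⊆ s, t.Nonempty → t.card ≤ 2 * V + 1 → ∑ i ∈ t, x i ≠ 0
    · exact ⟨∅, by simp, by simp, by simpa using card_le_of_forall_zero_sum hx hS h⟩
    push Not at h
    obtain ⟨t, hts, htn, htc, ht0⟩ := h
    have hsum := Finset.sum_sdiff (f := x) hts
    rw [ht0, add_zero] at hsum
    obtain ⟨G, hG₁, hG₂, hG₃⟩ := ih (s \ t) (Finset.sdiff_ssubset hts htn)
      (fun i hi => hx i (Finset.mem_sdiff.1 hi).1) (by rwa [hsum])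
    refine ⟨insert t G, ?_, ?_, ?_⟩
    · rw [Finset.coe_insert]
      refine hG₁.insert fun g hg _ => ?_
      exact Finset.disjoint_of_subset_right (hG₂ g hg).1 Finset.disjoint_sdiff
    · intro g hg
      rcases Finset.mem_insert.1 hg with rfl | hg
      · exact ⟨hts, htn, htc, ht0⟩
      · obtain ⟨h₁, h₂⟩ := hG₂ g hg
        exact ⟨h₁.trans Finset.sdiff_subset, h₂⟩
    · rwa [Finset.biUnion_insert, id, ← Finset.sup_eq_union, ← sdiff_sdiff_left]

/-- One coordinate of the bound of `exists_zero_sum_subset`: from a bound `V` on the entries, a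
bound `S` on the sum, and a weight `c` of each vector, the bounds and the weight for the groups of
vectors whose coordinate has sum zero, and the weight `e` of the vectors left over so far. -/
def zeroSumStep : ℕ × ℕ × ℕ × ℕ → ℕ × ℕ × ℕ × ℕ
  | (V, S, c, e) => ((2 * V + 1) * V, S + (V * V * V + V * V + S) * V, c * (2 * V + 1),
      e + c * (V * V * V + V * V + S))

/-- A large family of integer vectors with bounded entries and bounded sum has a nonempty subfamily
with sum zero. The coordinates are treated one after the other, the vectors being grouped into
groups of bounded size whose sums vanish in that coordinate. -/
theorem exists_zero_sum_subset (m : ℕ) : ∀ {ι : Type} [DecidableEq ι] (s : Finset ι)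
    (x : ℕ → ι → ℤ) (V S c e : ℕ), (∀ p < m, ∀ i ∈ s, |x p i| ≤ V) →
    (∀ p < m, |∑ i ∈ s, x p i| ≤ S) → (zeroSumStep^[m] (V, S, c, e)).2.2.2 < c * s.card + e →
    ∃ t ⊆ s, t.Nonempty ∧ ∀ p < m, ∑ i ∈ t, x p i = 0 := by
  induction m with
  | zero =>
    intro ι _ s x V S c e _ _ h
    refine ⟨s, subset_rfl, Finset.card_pos.1 (Nat.pos_of_ne_zero fun h0 => ?_), by simp⟩
    simp [h0] at h
  | succ m ih =>
    intro ι _ s x V S c e hV hS h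
    obtain ⟨G, hG₁, hG₂, hG₃⟩ := exists_disjoint_zero_sum s (hV m m.lt_succ_self)
      (hS m m.lt_succ_self)
    set L := V * V * V + V * V + S with hL
    have hsub : G.biUnion id ⊆ s := Finset.biUnion_subset.2 fun g hg => (hG₂ g hg).1
    have hcard : s.card ≤ L + (2 * V + 1) * G.card := by
      have h₁ := Finset.card_sdiff_add_card_eq_card hsub
      have h₂ : (G.biUnion id).card ≤ G.card * (2 * V + 1) :=
        Finset.card_biUnion_le_card_mul _ _ _ fun g hg => (hG₂ g hg).2.2.1
      rw [mul_comm] at h₂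
      omega
    have hV' : ∀ p < m, ∀ g ∈ G, |∑ i ∈ g, x p i| ≤ ((2 * V + 1) * V : ℕ) := by
      intro p hp g hg
      refine (Finset.abs_sum_le_sum_abs _ _).trans ?_
      have h₁ : ∑ i ∈ g, |x p i| ≤ g.card • (V : ℤ) := Finset.sum_le_card_nsmul _ _ _ fun i hi =>
        hV p (hp.trans m.lt_succ_self) i ((hG₂ g hg).1 hi)
      have h₂ : g.card * V ≤ (2 * V + 1) * V := Nat.mul_le_mul_right _ (hG₂ g hg).2.2.1
      rw [nsmul_eq_mul] at h₁
      exact h₁.trans (by exact_mod_cast h₂)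
    have hS' : ∀ p < m, |∑ g ∈ G, ∑ i ∈ g, x p i| ≤ (S + L * V : ℕ) := by
      intro p hp
      have hp' := hp.trans m.lt_succ_self
      have h₀ : ∑ g ∈ G, ∑ i ∈ g, x p i = ∑ i ∈ G.biUnion id, x p i :=
        (Finset.sum_biUnion hG₁).symm
      have h₁ := Finset.sum_sdiff (f := x p) hsub
      have h₂ : |∑ i ∈ s \ G.biUnion id, x p i| ≤ (L * V : ℕ) := by
        refine (Finset.abs_sum_le_sum_abs _ _).trans ((Finset.sum_le_card_nsmul _ _ (V : ℤ)
          fun i hi => hV p hp' i (Finset.mem_sdiff.1 hi).1).trans ?_)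
        rw [nsmul_eq_mul]
        exact_mod_cast Nat.mul_le_mul_right V hG₃
      have h₃ := hS p hp'
      rw [h₀, eq_sub_of_add_eq' h₁]
      refine (abs_sub _ _).trans ?_
      push_cast at h₂ ⊢
      linarith
    have h' : (zeroSumStep^[m] ((2 * V + 1) * V, S + L * V, c * (2 * V + 1), e + c * L)).2.2.2 <
        c * (2 * V + 1) * G.card + (e + c * L) := by
      rw [Function.iterate_succ_apply] at h
      refine lt_of_lt_of_le h ?_
      calc c * s.card + e ≤ c * (L + (2 * V + 1) * G.card) + e := by gcongr
        _ = _ := by ring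
    obtain ⟨t, htG, htn, ht⟩ := ih G (fun p g => ∑ i ∈ g, x p i) ((2 * V + 1) * V) (S + L * V)
      (c * (2 * V + 1)) (e + c * L) hV' hS' h'
    refine ⟨t.biUnion id, (Finset.biUnion_subset_biUnion_of_subset_left _ htG).trans hsub, ?_, ?_⟩
    · obtain ⟨g, hg⟩ := htn
      obtain ⟨i, hi⟩ := (hG₂ g (htG hg)).2.1
      exact ⟨i, Finset.mem_biUnion.2 ⟨g, hg, hi⟩⟩
    · intro p hp
      rw [Finset.sum_biUnion (hG₁.subset (by exact_mod_cast htG))]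
      rcases Nat.lt_succ_iff_lt_or_eq.1 hp with hp | rfl
      · exact ht p hp
      · exact Finset.sum_eq_zero fun g hg => (hG₂ g (htG hg)).2.2.2

end ZeroSum

/-! ### Completing assignments between requirers and providers -/

section Assignment

variable {ι : Type*} [DecidableEq ι]

/-- `E` assigns to each element `u` of `V` at most `d u` other elements of `V`, such that each
element `v` is assigned at most `c v` times. -/
structure IsAssignment (V : Finset ι) (d c : ι → ℕ) (E : Finset (ι × ι)) : Prop where
  mem : ∀ e ∈ E, e.1 ∈ V ∧ e.2 ∈ V ∧ e.1 ≠ e.2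
  out_le : ∀ u, (E.filter fun e => e.1 = u).card ≤ d u
  in_le : ∀ v, (E.filter fun e => e.2 = v).card ≤ c v

/-- An assignment with sufficiently many pairs that leaves a demand open can be enlarged. If `u`
lacks a partner and `v` has free capacity, but `(u, v)` cannot be added, then some pair `(u', v')`
can be replaced by `(u, v')` and `(u', v)`, as all but few pairs are unrelated to `u` and `v`. -/
theorem IsAssignment.exists_card_lt {V : Finset ι} {d c : ι → ℕ} {D : ℕ} {E : Finset (ι × ι)}
    (hE : IsAssignment V d c E) (hd : ∀ u, d u ≤ D) (hc : ∀ v, c v ≤ D)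
    (hsum : ∑ u ∈ V, d u ≤ ∑ v ∈ V, c v) (hcard : 2 * D * D + 2 * D < E.card) {u : ι} (hu : u ∈ V)
    (hlt : (E.filter fun e => e.1 = u).card < d u) :
    ∃ E', IsAssignment V d c E' ∧ E.card < E'.card := by
  obtain ⟨v, hv, hvlt⟩ : ∃ v ∈ V, (E.filter fun e => e.2 = v).card < c v := by
    by_contra! hcon
    have h₁ := Finset.card_eq_sum_card_fiberwise (s := E) (f := Prod.fst) (t := V)
      fun e he => (hE.mem e he).1
    have h₂ := Finset.card_eq_sum_card_fiberwise (s := E) (f := Prod.snd) (t := V)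
      fun e he => (hE.mem e he).2.1
    have h₃ := Finset.sum_lt_sum (fun w _ => hE.out_le w) ⟨u, hu, hlt⟩
    have h₄ := Finset.sum_le_sum hcon
    omega
  by_cases huv : u ≠ v ∧ (u, v) ∉ E
  · refine ⟨insert (u, v) E, ⟨?_, fun w => ?_, fun w => ?_⟩, by
      rw [Finset.card_insert_of_notMem huv.2]; exact Nat.lt_succ_self _⟩
    · intro e he
      rcases Finset.mem_insert.1 he with rfl | he
      · exact ⟨hu, hv, huv.1⟩
      · exact hE.mem e he
    · rw [Finset.filter_insert]
      split_ifs with h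
      · subst h
        exact (Finset.card_insert_le _ _).trans hlt
      · exact hE.out_le w
    · rw [Finset.filter_insert]
      split_ifs with h
      · subst h
        exact (Finset.card_insert_le _ _).trans hvlt
      · exact hE.in_le w
  obtain ⟨⟨u', v'⟩, he, h₁, h₂, h₃, h₄⟩ : ∃ e ∈ E, e.2 ≠ u ∧ e.1 ≠ v ∧ (u, e.2) ∉ E ∧
      (e.1, v) ∉ E := by
    by_contra! hcon
    have hsub : E ⊆ (E.filter fun e => e.2 = u) ∪ (E.filter fun e => e.1 = v) ∪
        ((E.filter fun e => (u, e.2) ∈ E) ∪ (E.filter fun e => (e.1, v) ∈ E)) := by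
      intro e he
      have := hcon e he
      simp only [Finset.mem_union, Finset.mem_filter]
      tauto
    have c₁ := (hE.in_le u).trans (hc u)
    have c₂ := (hE.out_le v).trans (hd v)
    have c₃ : (E.filter fun e => (u, e.2) ∈ E).card ≤ D * D := by
      refine (Finset.card_le_mul_card_image_of_maps_to (f := Prod.snd)
        (t := (E.filter fun e => e.1 = u).image Prod.snd) ?_ D fun w _ => ?_).trans
        (Nat.mul_le_mul_left _ (Finset.card_image_le.trans ((hE.out_le u).trans (hd u))))
      · intro e he
        exact Finset.mem_image.2 ⟨(u, e.2), by simpa using (Finset.mem_filter.1 he).2, rfl⟩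
      · refine (Finset.card_le_card ?_).trans ((hE.in_le w).trans (hc w))
        exact Finset.filter_subset_filter _ (Finset.filter_subset _ _)
    have c₄ : (E.filter fun e => (e.1, v) ∈ E).card ≤ D * D := by
      refine (Finset.card_le_mul_card_image_of_maps_to (f := Prod.fst)
        (t := (E.filter fun e => e.2 = v).image Prod.fst) ?_ D fun w _ => ?_).trans
        (Nat.mul_le_mul_left _ (Finset.card_image_le.trans ((hE.in_le v).trans (hc v))))
      · intro e he
        exact Finset.mem_image.2 ⟨(e.1, v), by simpa using (Finset.mem_filter.1 he).2, rfl⟩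
      · refine (Finset.card_le_card ?_).trans ((hE.out_le w).trans (hd w))
        exact Finset.filter_subset_filter _ (Finset.filter_subset _ _)
    have := (Finset.card_le_card hsub).trans ((Finset.card_union_le _ _).trans
      (Nat.add_le_add (Finset.card_union_le _ _) (Finset.card_union_le _ _)))
    have e : 2 * D * D = D * D + D * D := by ring
    omega
  simp only at h₁ h₂ h₃ h₄
  have huu' : u ≠ u' := fun h => h₃ (h ▸ he)
  have hvv' : v ≠ v' := fun h => h₄ (h ▸ he)
  have hm := hE.mem _ he
  refine ⟨insert (u, v') (insert (u', v) (E.erase (u', v'))), ⟨?_, fun w => ?_, fun w => ?_⟩, ?_⟩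
  · intro e he'
    simp only [Finset.mem_insert, Finset.mem_erase] at he'
    rcases he' with rfl | rfl | he'
    · exact ⟨hu, hm.2.1, h₁.symm⟩
    · exact ⟨hm.1, hv, h₂⟩
    · exact hE.mem e he'.2
  · rw [Finset.filter_insert, Finset.filter_insert, Finset.filter_erase]
    have := hE.out_le w
    by_cases hw : w = u
    · subst hw
      rw [if_pos rfl, if_neg huu'.symm]
      refine (Finset.card_insert_le _ _).trans (le_trans ?_ hlt)
      exact Nat.succ_le_succ (Finset.card_le_card (Finset.erase_subset _ _))
    · rw [if_neg (Ne.symm hw)]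
      split_ifs with h
      · subst h
        refine (Finset.card_insert_le _ _).trans (le_trans ?_ this)
        rw [Finset.card_erase_add_one]
        simpa using he
      · exact (Finset.card_le_card (Finset.erase_subset _ _)).trans this
  · rw [Finset.filter_insert, Finset.filter_insert, Finset.filter_erase]
    have := hE.in_le w
    by_cases hw : w = v
    · subst hw
      rw [if_neg hvv'.symm, if_pos rfl]
      refine (Finset.card_insert_le _ _).trans (le_trans ?_ hvlt)
      exact Nat.succ_le_succ (Finset.card_le_card (Finset.erase_subset _ _))
    · rw [if_neg (Ne.symm hw)]
      split_ifs with h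
      · subst h
        refine (Finset.card_insert_le _ _).trans (le_trans ?_ this)
        rw [Finset.card_erase_add_one]
        simpa using he
      · exact (Finset.card_le_card (Finset.erase_subset _ _)).trans this
  · rw [Finset.card_insert_of_notMem, Finset.card_insert_of_notMem, Finset.card_erase_add_one he]
    · exact Nat.lt_succ_self _
    · exact fun h => h₄ (Finset.mem_of_mem_erase h)
    · intro h
      rcases Finset.mem_insert.1 h with h | h
      · exact huu' (congrArg Prod.fst h)
      · exact h₃ (Finset.mem_of_mem_erase h)

/-- If the demands are bounded and do not exceed the capacities in total, then any sufficiently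
large assignment witnesses that all demands can be met. -/
theorem IsAssignment.exists_saturated {V : Finset ι} {d c : ι → ℕ} {D : ℕ} {E₀ : Finset (ι × ι)}
    (h₀ : IsAssignment V d c E₀) (hd : ∀ u, d u ≤ D) (hc : ∀ v, c v ≤ D)
    (hsum : ∑ u ∈ V, d u ≤ ∑ v ∈ V, c v) (hcard : 2 * D * D + 2 * D < E₀.card) :
    ∃ E, IsAssignment V d c E ∧ ∀ u ∈ V, (E.filter fun e => e.1 = u).card = d u := by
  classical
  have hsub : ∀ E, IsAssignment V d c E → E ∈ (V ×ˢ V).powerset := fun E hE =>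
    Finset.mem_powerset.2 fun e he =>
      Finset.mem_product.2 ⟨(hE.mem e he).1, (hE.mem e he).2.1⟩
  obtain ⟨E, hE, hmax⟩ := Finset.exists_max_image
    ((V ×ˢ V).powerset.filter (IsAssignment V d c)) Finset.card
    ⟨E₀, Finset.mem_filter.2 ⟨hsub _ h₀, h₀⟩⟩
  have hE' := (Finset.mem_filter.1 hE).2
  refine ⟨E, hE', fun u hu => (hE'.out_le u).antisymm (not_lt.1 fun hlt => ?_)⟩
  obtain ⟨E', hE'', hlt'⟩ := hE'.exists_card_lt hd hc hsum
    (hcard.trans_le (hmax _ (Finset.mem_filter.2 ⟨hsub _ h₀, h₀⟩))) hu hlt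
  exact absurd (hmax _ (Finset.mem_filter.2 ⟨hsub _ hE'', hE''⟩)) (not_le.2 hlt')

end Assignment

namespace Microservice

/-! ### Shrinking correct configurations -/

variable {k : ℕ}

/-- Interface `p` is required, strongly or weakly, by `T`. -/
def MType.Requires (T : MType k) (p : ℕ) : Prop := p ∈ dom T.reqS ∪ dom T.reqW

/-- The number of providers of `p` that `T` requires; it is `0` if `T` does not require `p`. -/
def MType.demand (T : MType k) (p : ℕ) : ℕ :=
  ((T.reqS ∪ T.reqW).filter fun x => x.1 = p).sup Prod.snd

/-- Interface `p` is provided by `T`, with infinite capacity. -/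
def MType.Unlimited (T : MType k) (p : ℕ) : Prop :=
  p ∈ dom T.prov ∧ ∀ n, (p, n) ∈ T.prov → n = ⊤

/-- The required interfaces, the demands and the finite capacities in `U` are at most `a`. -/
def BoundedBy (U : Finset (MType k)) (a : ℕ) : Prop :=
  ∀ T ∈ U, (∀ x ∈ T.reqS ∪ T.reqW, x.1 < a ∧ x.2 ≤ a) ∧ ∀ x ∈ T.prov, x.2 = ⊤ ∨ x.2 ≤ a

open Classical in
/-- A correct final configuration for `I`, given by a set `V` of microservices and by functions for
the types, the nodes and the bindings, whose values outside of `V` do not matter. -/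
structure IsDeployment (I : Input k) (V : Finset ℕ) (τ : ℕ → MType k) (ν : ℕ → Node k)
    (b : ℕ → ℕ → ℕ → Prop) : Prop where
  type_mem : ∀ z ∈ V, τ z ∈ I.U
  node_mem : ∀ z ∈ V, ν z ∈ I.O
  resources : ∀ o r, ∑ z ∈ V with ν z = o, (τ z).res r ≤ o.res r
  binding : ∀ z ∈ V, ∀ z' ∈ V, ∀ p, b p z z' →
    z ≠ z' ∧ (τ z).Requires p ∧ p ∈ dom (τ z').prov
  demand : ∀ z ∈ V, ∀ p n, (p, n) ∈ (τ z).reqS ∪ (τ z).reqW → n ≤ (V.filter (b p z)).card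
  capacity : ∀ z ∈ V, ∀ p n, (p, n) ∈ (τ z).prov →
    ((V.filter fun z' => b p z' z).card : ℕ∞) ≤ n
  noConflict : ∀ z ∈ V, ∀ p ∈ (τ z).conf, ∀ z' ∈ V, z' ≠ z → p ∉ dom (τ z').prov
  target : ∃ z ∈ V, τ z = I.target

theorem mem_dom {α β : Type*} [DecidableEq α] {f : Finset (α × β)} {a : α} :
    a ∈ dom f ↔ ∃ b, (a, b) ∈ f := by
  simp [dom]

theorem mem_ran {α β : Type*} [DecidableEq β] {f : Finset (α × β)} {b : β} :
    b ∈ ran f ↔ ∃ a, (a, b) ∈ f := by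
  simp [ran]

theorem MType.requires_iff {T : MType k} {p : ℕ} :
    T.Requires p ↔ ∃ n, (p, n) ∈ T.reqS ∪ T.reqW := by
  simp [Requires, mem_dom, exists_or]

theorem MType.le_demand {T : MType k} {p n : ℕ} (h : (p, n) ∈ T.reqS ∪ T.reqW) :
    n ≤ T.demand p :=
  Finset.le_sup (f := Prod.snd) (b := (p, n)) (Finset.mem_filter.2 ⟨h, rfl⟩)

theorem MType.demand_le {T : MType k} {p m : ℕ}
    (h : ∀ n, (p, n) ∈ T.reqS ∪ T.reqW → n ≤ m) : T.demand p ≤ m := by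
  refine Finset.sup_le fun x hx => h x.2 ?_
  obtain ⟨hx', rfl⟩ := Finset.mem_filter.1 hx
  exact hx'

theorem BoundedBy.demand_le {U : Finset (MType k)} {a : ℕ} (h : BoundedBy U a) {T : MType k}
    (hT : T ∈ U) (p : ℕ) : T.demand p ≤ a :=
  MType.demand_le fun _ hn => ((h T hT).1 _ hn).2

theorem card_filter_fst_eq {V : Finset ℕ} {E : Finset (ℕ × ℕ)} (h : ∀ e ∈ E, e.2 ∈ V) (u : ℕ) :
    (E.filter fun e => e.1 = u).card = (V.filter fun v => (u, v) ∈ E).card := by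
  rw [← Finset.card_image_of_injective (V.filter fun v => (u, v) ∈ E) (Prod.mk_right_injective u)]
  congr 1
  ext ⟨x, y⟩
  simp only [Finset.mem_filter, Finset.mem_image, Prod.mk.injEq]
  constructor
  · rintro ⟨hE, rfl⟩
    exact ⟨y, ⟨h _ hE, hE⟩, rfl, rfl⟩
  · rintro ⟨y, ⟨_, hE⟩, rfl, rfl⟩
    exact ⟨hE, rfl⟩

theorem card_filter_snd_eq {V : Finset ℕ} {E : Finset (ℕ × ℕ)} (h : ∀ e ∈ E, e.1 ∈ V) (v : ℕ) :
    (E.filter fun e => e.2 = v).card = (V.filter fun u => (u, v) ∈ E).card := by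
  rw [← Finset.card_image_of_injective (V.filter fun u => (u, v) ∈ E) (Prod.mk_left_injective v)]
  congr 1
  ext ⟨x, y⟩
  simp only [Finset.mem_filter, Finset.mem_image, Prod.mk.injEq]
  constructor
  · rintro ⟨hE, rfl⟩
    exact ⟨x, ⟨h _ hE, hE⟩, rfl, rfl⟩
  · rintro ⟨x, ⟨_, hE⟩, rfl, rfl⟩
    exact ⟨hE, rfl⟩

/-- A way to satisfy the demands for `p` in `V`: the pairs in `h` bind requirers to the few
unlimited providers in `W`, and the pairs in `l` bind requirers to limited providers. -/
structure IsSplit (V : Finset ℕ) (τ : ℕ → MType k) (a p : ℕ) (W : Finset ℕ)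
    (h l : Finset (ℕ × ℕ)) : Prop where
  subset : W ⊆ V
  card_le : W.card ≤ a + 1
  unlimited : ∀ w ∈ W, (τ w).Unlimited p
  mem_h : ∀ e ∈ h, e.1 ∈ V ∧ e.2 ∈ W ∧ e.1 ≠ e.2 ∧ (τ e.1).Requires p
  mem_l : ∀ e ∈ l, e.1 ∈ V ∧ e.2 ∈ V ∧ e.1 ≠ e.2 ∧ (τ e.1).Requires p ∧
    p ∈ dom (τ e.2).prov ∧ ¬ (τ e.2).Unlimited p
  out_le : ∀ u, (l.filter fun e => e.1 = u).card ≤ a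
  in_le : ∀ v ∈ V, ∀ n, (p, n) ∈ (τ v).prov → ((l.filter fun e => e.2 = v).card : ℕ∞) ≤ n
  demand : ∀ z ∈ V, (τ z).demand p ≤
    (h.filter fun e => e.1 = z).card + (l.filter fun e => e.1 = z).card

/-- Limited providers receive at most `a` bindings, and unlimited ones are not used by `l`. -/
theorem IsSplit.in_le_bound {I : Input k} {V : Finset ℕ} {τ : ℕ → MType k} {a p : ℕ}
    {W : Finset ℕ} {h l : Finset (ℕ × ℕ)} (hs : IsSplit V τ a p W h l)
    (hτ : ∀ z ∈ V, τ z ∈ I.U) (ha : BoundedBy I.U a) (v : ℕ) :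
    (l.filter fun e => e.2 = v).card ≤ a := by
  by_contra! hlt
  obtain ⟨e, he⟩ := Finset.card_pos.1 (Nat.zero_lt_of_lt hlt)
  obtain ⟨he', rfl⟩ := Finset.mem_filter.1 he
  obtain ⟨-, hV, -, -, hp, hu⟩ := hs.mem_l e he'
  obtain ⟨n, hn, hn'⟩ : ∃ n, (p, n) ∈ (τ e.2).prov ∧ n ≠ ⊤ := by
    by_contra! hcon
    exact hu ⟨hp, hcon⟩
  have h₁ := hs.in_le _ hV _ hn
  have h₂ := ((ha _ (hτ _ hV)).2 _ hn).resolve_left hn'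
  exact absurd (Nat.cast_le.1 (h₁.trans h₂)) (not_le.2 hlt)

/-- If there are more than `a` unlimited providers, all requirers are bound to `a + 1` of them;
otherwise bindings to limited providers are kept only as far as they are needed. -/
theorem IsDeployment.exists_split {I : Input k} {V : Finset ℕ} {τ : ℕ → MType k} {ν : ℕ → Node k}
    {b : ℕ → ℕ → ℕ → Prop} (hd : IsDeployment I V τ ν b) {a : ℕ} (ha : BoundedBy I.U a) (p : ℕ) :
    ∃ W h l, IsSplit V τ a p W h l := by
  classical
  set H := V.filter fun z => (τ z).Unlimited p with hH
  have hreq : ∀ z, (τ z).demand p ≠ 0 → (τ z).Requires p := fun z hz => by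
    by_contra hcon
    refine hz (Nat.le_zero.1 (MType.demand_le fun n hn => absurd ?_ hcon))
    exact MType.requires_iff.2 ⟨n, hn⟩
  by_cases hc : a + 1 ≤ H.card
  · obtain ⟨W, hW, hWc⟩ := Finset.exists_subset_card_eq hc
    have hWV : W ⊆ V := hW.trans (Finset.filter_subset _ _)
    set h := (V ×ˢ W).filter fun e => e.1 ≠ e.2 ∧ (τ e.1).Requires p with hh
    have hmem : ∀ e ∈ h, e.1 ∈ V ∧ e.2 ∈ W ∧ e.1 ≠ e.2 ∧ (τ e.1).Requires p := fun e he => by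
      simpa [hh, and_assoc] using he
    refine ⟨W, h, ∅, hWV, hWc.le, fun w hw => (Finset.mem_filter.1 (hW hw)).2, hmem, by simp,
      by simp, by simp, fun z hz => ?_⟩
    by_cases hz' : (τ z).demand p = 0
    · simp [hz']
    rw [card_filter_fst_eq (V := W) (fun e he => (hmem e he).2.1)]
    have hsub : W.erase z ⊆ W.filter fun v => (z, v) ∈ h := fun w hw => by
      obtain ⟨h₁, h₂⟩ := Finset.mem_erase.1 hw
      exact Finset.mem_filter.2 ⟨h₂, Finset.mem_filter.2
        ⟨Finset.mem_product.2 ⟨hz, h₂⟩, h₁.symm, hreq z hz'⟩⟩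
    have h₁ := Finset.card_le_card hsub
    have h₂ := Finset.pred_card_le_card_erase (s := W) (a := z)
    have h₃ := ha.demand_le (hd.type_mem z hz) p
    omega
  · set h := (V ×ˢ H).filter fun e => b p e.1 e.2 with hh
    have hHV : H ⊆ V := Finset.filter_subset _ _
    have hmem : ∀ e ∈ h, e.1 ∈ V ∧ e.2 ∈ H ∧ e.1 ≠ e.2 ∧ (τ e.1).Requires p := fun e he => by
      obtain ⟨h₁, h₂⟩ := Finset.mem_filter.1 he
      obtain ⟨h₁, h₃⟩ := Finset.mem_product.1 h₁
      have h₄ := hd.binding _ h₁ _ (hHV h₃) p h₂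
      exact ⟨h₁, h₃, h₄.1, h₄.2.1⟩
    have hL : ∀ z, ∃ L ⊆ V.filter fun z' => b p z z' ∧ ¬ (τ z').Unlimited p, z ∈ V →
        L.card = (τ z).demand p - (h.filter fun e => e.1 = z).card := by
      intro z
      by_cases hz : z ∈ V
      swap
      · exact ⟨∅, by simp, fun h => absurd h hz⟩
      obtain ⟨L, hL, hLc⟩ := Finset.exists_subset_card_eq (s := V.filter fun z' =>
        b p z z' ∧ ¬ (τ z').Unlimited p)
        (n := (τ z).demand p - (h.filter fun e => e.1 = z).card) (by
          rw [card_filter_fst_eq (V := H) (fun e he => (hmem e he).2.1), tsub_le_iff_left]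
          refine (MType.demand_le (hd.demand z hz p)).trans ?_
          refine (Finset.card_le_card ?_).trans (Finset.card_union_le _ _)
          intro z' hz'
          obtain ⟨h₁, h₂⟩ := Finset.mem_filter.1 hz'
          by_cases hu : (τ z').Unlimited p
          · have h₃ : z' ∈ H := Finset.mem_filter.2 ⟨h₁, hu⟩
            exact Finset.mem_union_left _ (Finset.mem_filter.2 ⟨h₃, Finset.mem_filter.2
              ⟨Finset.mem_product.2 ⟨hz, h₃⟩, h₂⟩⟩)
          · exact Finset.mem_union_right _ (Finset.mem_filter.2 ⟨h₁, h₂, hu⟩))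
      exact ⟨L, hL, fun _ => hLc⟩
    choose L hL hLc using hL
    set l := (V ×ˢ V).filter fun e => e.2 ∈ L e.1 with hl
    have hlb : ∀ e ∈ l, e.1 ∈ V ∧ e.2 ∈ V ∧ b p e.1 e.2 ∧ ¬ (τ e.2).Unlimited p := by
      intro e he
      obtain ⟨h₁, h₂⟩ := Finset.mem_filter.1 he
      obtain ⟨h₁, h₃⟩ := Finset.mem_product.1 h₁
      exact ⟨h₁, h₃, (Finset.mem_filter.1 (hL _ h₂)).2⟩
    have hout : ∀ z ∈ V, (l.filter fun e => e.1 = z).card = (L z).card := by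
      intro z hz
      rw [card_filter_fst_eq (V := V) (fun e he => (hlb e he).2.1)]
      congr 1
      ext z'
      have : z' ∈ L z → z' ∈ V := fun h' => (Finset.mem_filter.1 (hL z h')).1
      simp only [hl, Finset.mem_filter, Finset.mem_product]
      tauto
    refine ⟨H, h, l, hHV, by omega, fun w hw => (Finset.mem_filter.1 hw).2, hmem, ?_, ?_, ?_, ?_⟩
    · intro e he
      obtain ⟨h₁, h₂, h₃, h₄⟩ := hlb e he
      obtain ⟨h₅, h₆, h₇⟩ := hd.binding _ h₁ _ h₂ p h₃
      exact ⟨h₁, h₂, h₅, h₆, h₇, h₄⟩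
    · intro u
      by_cases hu : u ∈ V
      · rw [hout u hu, hLc u hu]
        exact (Nat.sub_le _ _).trans (ha.demand_le (hd.type_mem u hu) p)
      · rw [Finset.filter_false_of_mem fun e he => by rintro rfl; exact hu (hlb e he).1]
        simp
    · intro v hv n hn
      refine le_trans (Nat.cast_le.2 ?_) (hd.capacity v hv p n hn)
      rw [card_filter_snd_eq (V := V) (fun e he => (hlb e he).1)]
      refine Finset.card_le_card fun z hz => ?_
      obtain ⟨h₁, h₂⟩ := Finset.mem_filter.1 hz
      exact Finset.mem_filter.2 ⟨h₁, (hlb _ h₂).2.2.1⟩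
    · intro z hz
      rw [hout z hz, hLc z hz]
      omega

/-- A bound on the number of microservices that are protected from removal. -/
def protectedBound (a : ℕ) : ℕ := 1 + a * (a + 1 + 2 * (2 * a * a + 2 * a + 1))

/-- A bound on the number of microservices needed in a correct final configuration. -/
def sizeBound (a : ℕ) : ℕ :=
  (zeroSumStep^[a] (a, protectedBound a * a, 1, 0)).2.2.2 + protectedBound a

/-- A large deployment contains a smaller one, obtained by removing a nonempty set of
microservices. For each interface, the removed microservices occupy as much limited capacity as
they use, so that the bindings to limited providers can be rearranged. Some microservices are
protected from removal: one of the target type, the unlimited providers that are in use, and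
the ends of so many bindings to limited providers that the rearrangement is possible. -/
theorem IsDeployment.exists_ssubset {I : Input k} {V : Finset ℕ} {τ : ℕ → MType k}
    {ν : ℕ → Node k} {b : ℕ → ℕ → ℕ → Prop} (hd : IsDeployment I V τ ν b) {a : ℕ}
    (ha : BoundedBy I.U a) (hcard : sizeBound a < V.card) :
    ∃ V' ⊂ V, ∃ b', IsDeployment I V' τ ν b' := by
  classical
  choose W h l hs using hd.exists_split ha
  obtain ⟨t, htV, ht⟩ := hd.target
  have hF : ∀ p, ∃ F ⊆ l p, F.card ≤ 2 * a * a + 2 * a + 1 ∧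
      (F = l p ∨ 2 * a * a + 2 * a < F.card) := by
    intro p
    by_cases hc : (l p).card ≤ 2 * a * a + 2 * a + 1
    · exact ⟨l p, subset_rfl, hc, Or.inl rfl⟩
    · obtain ⟨F, hF, hFc⟩ := Finset.exists_subset_card_eq (not_le.1 hc).le
      exact ⟨F, hF, hFc.le, Or.inr (by omega)⟩
  choose F hFl hFc hF using hF
  set P : Finset ℕ := insert t ((Finset.range a).biUnion fun p =>
    W p ∪ ((F p).image Prod.fst ∪ (F p).image Prod.snd)) with hP
  have hPc : P.card ≤ protectedBound a := by
    refine (Finset.card_insert_le _ _).trans ?_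
    rw [protectedBound, add_comm]
    refine Nat.add_le_add_left ((Finset.card_biUnion_le_card_mul _ _
      (a + 1 + 2 * (2 * a * a + 2 * a + 1)) fun p _ => ?_).trans (by simp)) 1
    have h₁ := Finset.card_union_le (W p) ((F p).image Prod.fst ∪ (F p).image Prod.snd)
    have h₂ := Finset.card_union_le ((F p).image Prod.fst) ((F p).image Prod.snd)
    have h₃ := Finset.card_image_le (s := F p) (f := Prod.fst)
    have h₄ := Finset.card_image_le (s := F p) (f := Prod.snd)
    have h₅ := (hs p).card_le
    have h₆ := hFc p
    omega
  have hmemP : ∀ p < a, ∀ z, z ∈ W p ∨ z ∈ (F p).image Prod.fst ∨ z ∈ (F p).image Prod.snd →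
      z ∈ P := fun p hp z hz => Finset.mem_insert_of_mem (Finset.mem_biUnion.2
        ⟨p, Finset.mem_range.2 hp, by simpa only [Finset.mem_union] using hz⟩)
  -- The bindings of `u` to limited providers, and the bindings that the limited provider `v`
  -- receives, serve as demands and capacities.
  set d : ℕ → ℕ → ℕ := fun p u => ((l p).filter fun e => e.1 = u).card with hdd
  set c : ℕ → ℕ → ℕ := fun p v => ((l p).filter fun e => e.2 = v).card with hcc
  have hda : ∀ p u, d p u ≤ a := fun p u => (hs p).out_le u
  have hca : ∀ p v, c p v ≤ a := fun p v => (hs p).in_le_bound hd.type_mem ha v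
  have hdc : ∀ p, ∑ z ∈ V, d p z = ∑ z ∈ V, c p z := fun p => by
    rw [← Finset.card_eq_sum_card_fiberwise (f := Prod.fst) fun e he => ((hs p).mem_l e he).1,
      ← Finset.card_eq_sum_card_fiberwise (f := Prod.snd) fun e he => ((hs p).mem_l e he).2.1]
  set x : ℕ → ℕ → ℤ := fun p z => c p z - d p z with hx
  have hxa : ∀ p z, |x p z| ≤ a := fun p z => by
    have h₁ := hda p z
    have h₂ := hca p z
    rw [abs_le]
    simp only [hx]
    omega
  have hxsum : ∀ p, ∑ z ∈ V, x p z = 0 := fun p => by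
    simp only [hx, Finset.sum_sub_distrib]
    have := hdc p
    zify at this
    omega
  obtain ⟨R, hRs, hRn, hR⟩ := exists_zero_sum_subset a (V \ P) x a (protectedBound a * a) 1 0
    (fun p _ z _ => hxa p z) (fun p _ => by
      have h₁ := Finset.sum_inter_add_sum_sdiff V P (x p)
      rw [hxsum, add_comm, ← eq_neg_iff_add_eq_zero] at h₁
      rw [h₁, abs_neg]
      refine (Finset.abs_sum_le_sum_abs _ _).trans
        ((Finset.sum_le_card_nsmul _ _ (a : ℤ) fun z _ => hxa p z).trans ?_)
      rw [nsmul_eq_mul]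
      have : (V ∩ P).card * a ≤ protectedBound a * a :=
        Nat.mul_le_mul_right _ ((Finset.card_le_card Finset.inter_subset_right).trans hPc)
      exact_mod_cast this) (by
      have h₁ := Finset.le_card_sdiff P V
      simp only [sizeBound] at hcard
      omega)
  have hRV : R ⊆ V := hRs.trans Finset.sdiff_subset
  set V' := V \ R with hV'
  have hV'V : V' ⊆ V := Finset.sdiff_subset
  have hPV' : ∀ z ∈ V, z ∈ P → z ∈ V' := fun z hz hzP => Finset.mem_sdiff.2
    ⟨hz, fun hzR => (Finset.mem_sdiff.1 (hRs hzR)).2 hzP⟩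
  have hE : ∀ p, ∃ E, p < a → IsAssignment V' (d p) (c p) E ∧
      ∀ u ∈ V', (E.filter fun e => e.1 = u).card = d p u := by
    intro p
    by_cases hp : p < a
    swap
    · exact ⟨∅, fun h => absurd h hp⟩
    have hFa : IsAssignment V' (d p) (c p) (F p) := by
      refine ⟨fun e he => ?_, fun u => ?_, fun v => ?_⟩
      · obtain ⟨h₁, h₂, h₃, -⟩ := (hs p).mem_l e (hFl p he)
        exact ⟨hPV' _ h₁ (hmemP p hp _ (Or.inr (Or.inl (Finset.mem_image_of_mem _ he)))),
          hPV' _ h₂ (hmemP p hp _ (Or.inr (Or.inr (Finset.mem_image_of_mem _ he)))), h₃⟩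
      · exact Finset.card_le_card (Finset.filter_subset_filter _ (hFl p))
      · exact Finset.card_le_card (Finset.filter_subset_filter _ (hFl p))
    rcases hF p with hFp | hFp
    · exact ⟨F p, fun _ => ⟨hFa, fun u _ => by rw [hFp]⟩⟩
    · have h₁ := Finset.sum_sdiff (f := x p) hRV
      rw [hxsum, hR p hp, add_zero] at h₁
      simp only [hx, Finset.sum_sub_distrib] at h₁
      have h₂ : ∑ z ∈ V', d p z = ∑ z ∈ V', c p z := by
        zify
        exact (sub_eq_zero.1 h₁).symm
      obtain ⟨E, hE⟩ := hFa.exists_saturated (hda p) (hca p) h₂.le hFp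
      exact ⟨E, fun _ => hE⟩
  choose E hE using hE
  have hEl : ∀ p < a, ∀ e ∈ E p, e.1 ∈ V' ∧ e.2 ∈ V' ∧ e.1 ≠ e.2 ∧ (τ e.1).Requires p ∧
      p ∈ dom (τ e.2).prov ∧ ¬ (τ e.2).Unlimited p := by
    intro p hp e he
    obtain ⟨h₁, h₂, h₃⟩ := (hE p hp).1.mem e he
    have hout : 0 < ((E p).filter fun e' => e'.1 = e.1).card :=
      Finset.card_pos.2 ⟨e, Finset.mem_filter.2 ⟨he, rfl⟩⟩
    have hin : 0 < ((E p).filter fun e' => e'.2 = e.2).card :=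
      Finset.card_pos.2 ⟨e, Finset.mem_filter.2 ⟨he, rfl⟩⟩
    obtain ⟨e₁, he₁⟩ := Finset.card_pos.1 (hout.trans_le ((hE p hp).1.out_le e.1))
    obtain ⟨e₂, he₂⟩ := Finset.card_pos.1 (hin.trans_le ((hE p hp).1.in_le e.2))
    obtain ⟨he₁l, he₁'⟩ := Finset.mem_filter.1 he₁
    obtain ⟨he₂l, he₂'⟩ := Finset.mem_filter.1 he₂
    have h₄ := (hs p).mem_l e₁ he₁l
    have h₅ := (hs p).mem_l e₂ he₂l
    rw [he₁'] at h₄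
    rw [he₂'] at h₅
    exact ⟨h₁, h₂, h₃, h₄.2.2.2.1, h₅.2.2.2.2⟩
  obtain ⟨b', hb'⟩ : ∃ b' : ℕ → ℕ → ℕ → Prop, ∀ p z z',
      b' p z z' ↔ p < a ∧ ((z, z') ∈ h p ∨ (z, z') ∈ E p) := ⟨_, fun _ _ _ => Iff.rfl⟩
  refine ⟨V', Finset.sdiff_ssubset hRV hRn, b',
    fun z hz => hd.type_mem z (hV'V hz), fun z hz => hd.node_mem z (hV'V hz), fun o r => ?_,
    ?_, ?_, ?_, fun z hz p hp z' hz' => hd.noConflict z (hV'V hz) p hp z' (hV'V hz'),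
    ⟨t, hPV' t htV (Finset.mem_insert_self _ _), ht⟩⟩
  · refine le_trans (Finset.sum_le_sum_of_subset ?_) (hd.resources o r)
    exact Finset.filter_subset_filter _ hV'V
  · intro z hz z' hz' p hb
    obtain ⟨hp, h₁ | h₁⟩ := (hb' _ _ _).1 hb
    · obtain ⟨h₂, h₃, h₄, h₅⟩ := (hs p).mem_h _ h₁
      exact ⟨h₄, h₅, ((hs p).unlimited _ h₃).1⟩
    · obtain ⟨h₂, h₃, h₄, h₅, h₆, -⟩ := hEl p hp _ h₁
      exact ⟨h₄, h₅, h₆⟩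
  · intro z hz p n hn
    have hp := ((ha _ (hd.type_mem z (hV'V hz))).1 _ hn).1
    refine (MType.le_demand hn).trans (((hs p).demand z (hV'V hz)).trans ?_)
    have hdz := (hE p hp).2 z hz
    simp only [hdd] at hdz
    rw [← hdz, card_filter_fst_eq (V := W p) fun e he => ((hs p).mem_h e he).2.1,
      card_filter_fst_eq (V := V') fun e he => ((hE p hp).1.mem e he).2.1,
      ← Finset.card_union_of_disjoint]
    · refine Finset.card_le_card fun z' hz' => ?_
      rcases Finset.mem_union.1 hz' with hz' | hz'
      · obtain ⟨h₁, h₂⟩ := Finset.mem_filter.1 hz'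
        exact Finset.mem_filter.2 ⟨hPV' _ ((hs p).subset h₁) (hmemP p hp _ (Or.inl h₁)),
          (hb' _ _ _).2 ⟨hp, Or.inl h₂⟩⟩
      · obtain ⟨h₁, h₂⟩ := Finset.mem_filter.1 hz'
        exact Finset.mem_filter.2 ⟨h₁, (hb' _ _ _).2 ⟨hp, Or.inr h₂⟩⟩
    · refine Finset.disjoint_left.2 fun z' h₁ h₂ => ?_
      exact (hEl p hp _ (Finset.mem_filter.1 h₂).2).2.2.2.2.2
        ((hs p).unlimited _ (Finset.mem_filter.1 h₁).1)
  · intro z hz p n hn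
    by_cases hu : (τ z).Unlimited p
    · rw [hu.2 n hn]
      exact le_top
    by_cases hp : p < a
    · refine le_trans (Nat.cast_le.2 ?_) ((hs p).in_le z (hV'V hz) n hn)
      refine le_trans ?_ ((hE p hp).1.in_le z)
      rw [card_filter_snd_eq (V := V') fun e he => ((hE p hp).1.mem e he).1]
      refine Finset.card_le_card fun z' hz' => ?_
      obtain ⟨h₁, h₂⟩ := Finset.mem_filter.1 hz'
      obtain ⟨-, h₂ | h₂⟩ := (hb' _ _ _).1 h₂
      · exact absurd ((hs p).unlimited _ ((hs p).mem_h _ h₂).2.1) hu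
      · exact Finset.mem_filter.2 ⟨h₁, h₂⟩
    · simp [hb', hp]

/-- A deployment contains one of bounded size; its nodes are among those of the given one. -/
theorem IsDeployment.exists_card_le {I : Input k} {τ : ℕ → MType k} {ν : ℕ → Node k} {a : ℕ}
    (ha : BoundedBy I.U a) (V : Finset ℕ) {b : ℕ → ℕ → ℕ → Prop} (hd : IsDeployment I V τ ν b) :
    ∃ V' ⊆ V, V'.card ≤ sizeBound a ∧ ∃ b', IsDeployment I V' τ ν b' := by
  induction V using Finset.strongInduction generalizing b with
  | H V ih =>
    by_cases hc : V.card ≤ sizeBound a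
    · exact ⟨V, subset_rfl, hc, b, hd⟩
    · obtain ⟨V₁, hV₁, b₁, hd₁⟩ := hd.exists_ssubset ha (not_le.1 hc)
      obtain ⟨V', hV', h⟩ := ih V₁ hV₁ hd₁
      exact ⟨V', hV'.trans hV₁.subset, h⟩

end Microservice

namespace Microservice

/-! ### Reachability of configurations -/

variable {k : ℕ}

/-- The configurations through which a solution may pass. -/
structure Admissible (I : Input k) (C : Config k) : Prop where
  provCorrect : C.ProvCorrect
  types : ∀ z T, (z, T) ∈ C.T → T ∈ I.U
  nodes : ∀ z o, (z, o) ∈ C.N → o ∈ I.O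

/-- An action leads from `C` to the admissible configuration `C'`. -/
def Move (I : Input k) (C C' : Config k) : Prop := (∃ a, Step C a C') ∧ Admissible I C'

/-- The configuration without microservices. -/
def Config.empty (k : ℕ) : Config k := ⟨∅, ∅, ∅, ∅⟩

/-- The part of `C` that consists of the microservices in `Z` and the bindings in `B`. -/
def Config.restrict (C : Config k) (Z : Finset ℕ) (B : Finset (ℕ × ℕ × ℕ)) : Config k :=
  ⟨Z, C.T.filter fun x => x.1 ∈ Z, C.N.filter fun x => x.1 ∈ Z, B⟩

theorem dom_filter {α β : Type*} [DecidableEq α] {f : Finset (α × β)} {s : Finset α}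
    (hs : s ⊆ dom f) : dom (f.filter fun x => x.1 ∈ s) = s := by
  ext a
  simp only [mem_dom, Finset.mem_filter]
  exact ⟨fun ⟨_, _, h⟩ => h, fun h => (mem_dom.1 (hs h)).imp fun b hb => ⟨hb, h⟩⟩

theorem Functional.mono {α β : Type*} {f g : Finset (α × β)} (hg : Functional g) (h : f ⊆ g) :
    Functional f :=
  fun a b b' h₁ h₂ => hg a b b' (h h₁) (h h₂)

theorem Config.IsConfig.exists_type {C : Config k} (hC : C.IsConfig) {z : ℕ} (hz : z ∈ C.Z) :
    ∃ T, (z, T) ∈ C.T :=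
  mem_dom.1 (hC.dom_T ▸ hz)

theorem Config.IsConfig.exists_node {C : Config k} (hC : C.IsConfig) {z : ℕ} (hz : z ∈ C.Z) :
    ∃ o, (z, o) ∈ C.N :=
  mem_dom.1 (hC.dom_N ▸ hz)

theorem Config.IsConfig.mem_Z_of_type {C : Config k} (hC : C.IsConfig) {z : ℕ} {T : MType k}
    (h : (z, T) ∈ C.T) : z ∈ C.Z :=
  hC.dom_T ▸ mem_dom.2 ⟨T, h⟩

theorem Config.IsConfig.mem_Z_of_node {C : Config k} (hC : C.IsConfig) {z : ℕ} {o : Node k}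
    (h : (z, o) ∈ C.N) : z ∈ C.Z :=
  hC.dom_N ▸ mem_dom.2 ⟨o, h⟩

theorem Config.IsConfig.mem_of_binding {C : Config k} (hC : C.IsConfig) {p z₁ z₂ : ℕ}
    (h : (p, z₁, z₂) ∈ C.B) : z₁ ∈ C.Z ∧ z₂ ∈ C.Z := by
  obtain ⟨-, T₁, T₂, h₁, h₂, -⟩ := hC.binding _ _ _ h
  exact ⟨hC.mem_Z_of_type h₁, hC.mem_Z_of_type h₂⟩

theorem Config.IsConfig.filter_T {C : Config k} (hC : C.IsConfig) :
    C.T.filter (fun x => x.1 ∈ C.Z) = C.T :=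
  Finset.filter_true_of_mem fun _ hx => hC.mem_Z_of_type hx

theorem Config.IsConfig.filter_N {C : Config k} (hC : C.IsConfig) :
    C.N.filter (fun x => x.1 ∈ C.Z) = C.N :=
  Finset.filter_true_of_mem fun _ hx => hC.mem_Z_of_node hx

theorem Config.IsConfig.restrict_self {C : Config k} (hC : C.IsConfig) :
    C.restrict C.Z C.B = C := by
  rw [restrict, hC.filter_T, hC.filter_N]

/-- Provisional correctness is inherited by parts that keep all strong providers. -/
theorem Config.ProvCorrect.restrict {C : Config k} (hC : C.ProvCorrect) {Z : Finset ℕ}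
    {B : Finset (ℕ × ℕ × ℕ)} (hZ : Z ⊆ C.Z) (hB : B ⊆ C.B)
    (hmem : ∀ p z₁ z₂, (p, z₁, z₂) ∈ B → z₁ ∈ Z ∧ z₂ ∈ Z)
    (hs : ∀ z ∈ Z, ∀ T, (z, T) ∈ C.T → ∀ p ∈ dom T.reqS, ∀ z', (p, z, z') ∈ C.B →
      (p, z, z') ∈ B) : (C.restrict Z B).ProvCorrect := by
  have hT : (C.restrict Z B).T ⊆ C.T := Finset.filter_subset _ _
  have hN : (C.restrict Z B).N ⊆ C.N := Finset.filter_subset _ _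
  refine ⟨⟨hC.isConfig.T_functional.mono hT, dom_filter (hC.isConfig.dom_T ▸ hZ),
    fun z T h => hC.isConfig.isType z T (hT h), hC.isConfig.N_functional.mono hN,
    dom_filter (hC.isConfig.dom_N ▸ hZ), fun p z₁ z₂ h => ?_⟩, fun o ho r => ?_,
    fun z T h p n hp => ?_, fun z T h p n hp => ?_⟩
  · obtain ⟨h₁, T₁, T₂, h₂, h₃, h₄⟩ := hC.isConfig.binding p z₁ z₂ (hB h)
    obtain ⟨h₅, h₆⟩ := hmem _ _ _ h
    exact ⟨h₁, T₁, T₂, Finset.mem_filter.2 ⟨h₂, h₅⟩, Finset.mem_filter.2 ⟨h₃, h₆⟩, h₄⟩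
  · refine (Finset.sum_le_sum_of_subset ?_).trans (hC.resources o ?_ r)
    · intro x hx
      obtain ⟨h₁, h₂⟩ := Finset.mem_filter.1 hx
      exact Finset.mem_filter.2 ⟨hT h₁, hN h₂⟩
    · obtain ⟨z, hz⟩ := mem_ran.1 ho
      exact mem_ran.2 ⟨z, hN hz⟩
  · obtain ⟨S, h₁, h₂, h₃⟩ := hC.strong z T (hT h) p n hp
    have hz : z ∈ Z := (Finset.mem_filter.1 h).2
    have hS : ∀ z' ∈ S, (p, z, z') ∈ B := fun z' hz' =>
      hs z hz T (hT h) p (mem_dom.2 ⟨n, hp⟩) z' (h₃ z' hz').1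
    refine ⟨S, fun z' hz' => Finset.mem_erase.2 ⟨Finset.ne_of_mem_erase (h₁ hz'),
      (hmem _ _ _ (hS z' hz')).2⟩, h₂, fun z' hz' => ⟨hS z' hz', ?_⟩⟩
    obtain ⟨T', hT', hp'⟩ := (h₃ z' hz').2
    exact ⟨T', Finset.mem_filter.2 ⟨hT', (hmem _ _ _ (hS z' hz')).2⟩, hp'⟩
  · rintro ⟨m, hm, S, h₁, h₂, h₃⟩
    refine hC.capacity z T (hT h) p n hp ⟨m, hm, S,
      h₁.trans (Finset.erase_subset_erase _ hZ), h₂, fun z' hz' => ?_⟩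
    obtain ⟨h₄, T', hT', hp'⟩ := h₃ z' hz'
    exact ⟨hB h₄, T', hT hT', hp'⟩

theorem Admissible.restrict {I : Input k} {C : Config k} (hC : Admissible I C) {Z : Finset ℕ}
    {B : Finset (ℕ × ℕ × ℕ)} (hZ : Z ⊆ C.Z) (hB : B ⊆ C.B)
    (hmem : ∀ p z₁ z₂, (p, z₁, z₂) ∈ B → z₁ ∈ Z ∧ z₂ ∈ Z)
    (hs : ∀ z ∈ Z, ∀ T, (z, T) ∈ C.T → ∀ p ∈ dom T.reqS, ∀ z', (p, z, z') ∈ C.B →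
      (p, z, z') ∈ B) : Admissible I (C.restrict Z B) :=
  ⟨hC.provCorrect.restrict hZ hB hmem hs, fun z T h => hC.types z T (Finset.mem_filter.1 h).1,
    fun z o h => hC.nodes z o (Finset.mem_filter.1 h).1⟩

theorem Config.del_eq_restrict {C : Config k} (hC : C.IsConfig) (z : ℕ) :
    C.del z = C.restrict (C.Z.erase z) (C.B.filter fun b => z ≠ b.2.1 ∧ z ≠ b.2.2) := by
  rw [del, restrict]
  congr 1
  · refine Finset.filter_congr fun x hx => ?_
    rw [Finset.mem_erase, and_iff_left (hC.mem_Z_of_type hx), ne_comm]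
  · refine Finset.filter_congr fun x hx => ?_
    rw [Finset.mem_erase, and_iff_left (hC.mem_Z_of_node hx), ne_comm]

/-- Since the strong dependency graph has no cycle, every nonempty finite set of types has a member
on which no member depends. -/
theorem WellFormed.exists_not_strongDep {U : Finset (MType k)} (hwf : WellFormed U)
    {S : Finset (MType k)} (hS : S.Nonempty) : ∃ T ∈ S, ∀ T₁ ∈ S, ¬ StrongDep U T₁ T := by
  have hirr : Std.Irrefl (Relation.TransGen (StrongDep U)) := ⟨hwf⟩
  have hord : IsStrictOrder (MType k) (Relation.TransGen (StrongDep U)) := {}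
  have hwf' := S.finite_toSet.wellFoundedOn (r := Relation.TransGen (StrongDep U))
  obtain ⟨T₀, hT₀⟩ := hS
  obtain ⟨⟨T, hT⟩, -, hmin⟩ := hwf'.has_min Set.univ ⟨⟨T₀, hT₀⟩, trivial⟩
  exact ⟨T, hT, fun T₁ h₁ h => hmin ⟨T₁, h₁⟩ trivial (.single h)⟩

theorem Admissible.exists_not_strongDep {I : Input k} (hwf : WellFormed I.U) {C : Config k}
    (hC : Admissible I C) (hne : C.Z.Nonempty) :
    ∃ z ∈ C.Z, ∃ T, (z, T) ∈ C.T ∧ ∀ z₁ T₁, (z₁, T₁) ∈ C.T → ¬ StrongDep I.U T₁ T := by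
  obtain ⟨z₀, hz₀⟩ := hne
  obtain ⟨T₀, hT₀⟩ := hC.provCorrect.isConfig.exists_type hz₀
  obtain ⟨T, hT, hmin⟩ := hwf.exists_not_strongDep ⟨T₀, mem_ran.2 ⟨z₀, hT₀⟩⟩
  obtain ⟨z, hz⟩ := mem_ran.1 hT
  exact ⟨z, hC.provCorrect.isConfig.mem_Z_of_type hz, T, hz, fun z₁ T₁ h₁ =>
    hmin T₁ (mem_ran.2 ⟨z₁, h₁⟩)⟩

/-- A microservice that is not a strong provider can be deleted. -/
theorem Admissible.del {I : Input k} {C : Config k} (hC : Admissible I C) {z : ℕ} {T : MType k}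
    (hz : (z, T) ∈ C.T) (hT : ∀ z₁ T₁, (z₁, T₁) ∈ C.T → ¬ StrongDep I.U T₁ T) :
    Admissible I (C.del z) := by
  have hC' := hC.provCorrect.isConfig
  rw [Config.del_eq_restrict hC']
  refine hC.restrict (Finset.erase_subset _ _) (Finset.filter_subset _ _) ?_ ?_
  · intro p z₁ z₂ h
    obtain ⟨h₁, h₂, h₃⟩ := Finset.mem_filter.1 h
    obtain ⟨h₄, h₅⟩ := hC'.mem_of_binding h₁
    exact ⟨Finset.mem_erase.2 ⟨h₂.symm, h₄⟩, Finset.mem_erase.2 ⟨h₃.symm, h₅⟩⟩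
  · intro z₁ hz₁ T₁ hT₁ p hp z' h
    refine Finset.mem_filter.2 ⟨h, (Finset.ne_of_mem_erase hz₁).symm, ?_⟩
    rintro rfl
    obtain ⟨-, T₁', T', h₁, h₂, -, h₃⟩ := hC'.binding _ _ _ h
    obtain rfl := hC'.T_functional _ _ _ hz h₂
    exact hT z₁ T₁ hT₁ ⟨hC.types _ _ hT₁, hC.types _ _ hz, p, Finset.mem_inter.2 ⟨hp, h₃⟩⟩

theorem Config.IsConfig.eq_empty {C : Config k} (hC : C.IsConfig) (h : C.Z = ∅) :
    C = Config.empty k := by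
  obtain ⟨Z, T, N, B⟩ := C
  obtain rfl : Z = ∅ := h
  have hT : T = ∅ := Finset.eq_empty_of_forall_notMem fun x hx =>
    absurd (hC.mem_Z_of_type (z := x.1) (T := x.2) hx) (Finset.notMem_empty _)
  have hN : N = ∅ := Finset.eq_empty_of_forall_notMem fun x hx =>
    absurd (hC.mem_Z_of_node (z := x.1) (o := x.2) hx) (Finset.notMem_empty _)
  have hB : B = ∅ := Finset.eq_empty_of_forall_notMem fun x hx =>
    absurd (hC.mem_of_binding (p := x.1) (z₁ := x.2.1) (z₂ := x.2.2) hx).1 (Finset.notMem_empty _)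
  rw [hT, hN, hB, empty]

/-- All microservices can be deleted, each before the strong providers it depends on. -/
theorem Admissible.reach_empty {I : Input k} (hwf : WellFormed I.U) (n : ℕ) :
    ∀ {C : Config k}, Admissible I C → C.Z.card = n →
      Relation.ReflTransGen (Move I) C (Config.empty k) := by
  induction n with
  | zero =>
    intro C hC hn
    rw [hC.provCorrect.isConfig.eq_empty (Finset.card_eq_zero.1 hn)]
  | succ n ih =>
    intro C hC hn
    obtain ⟨z, hz, T, hT, h⟩ := hC.exists_not_strongDep hwf (Finset.card_pos.1 (by omega))
    have hC' := hC.del hT h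
    refine .head ⟨⟨.del z, trivial, rfl⟩, hC'⟩ (ih hC' ?_)
    exact (Finset.card_erase_of_mem hz).trans (by omega)

/-- Weak bindings can be added one by one. -/
theorem Admissible.reach_add_bindings {I : Input k} {C : Config k} (hC : Admissible I C)
    {B : Finset (ℕ × ℕ × ℕ)} (hB : B ⊆ C.B)
    (hs : ∀ z ∈ C.Z, ∀ T, (z, T) ∈ C.T → ∀ p ∈ dom T.reqS, ∀ z', (p, z, z') ∈ C.B →
      (p, z, z') ∈ B) : Relation.ReflTransGen (Move I) (C.restrict C.Z B) C := by
  have hC' := hC.provCorrect.isConfig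
  suffices h : ∀ D ⊆ C.B \ B,
      Relation.ReflTransGen (Move I) (C.restrict C.Z B) (C.restrict C.Z (B ∪ D)) by
    have := h _ subset_rfl
    rwa [Finset.union_sdiff_of_subset hB, hC'.restrict_self] at this
  intro D
  induction D using Finset.induction_on with
  | empty => exact fun _ => by rw [Finset.union_empty]
  | insert b D hbD ih =>
    obtain ⟨p, z₁, z₂⟩ := b
    intro hD
    obtain ⟨hb, hD⟩ := Finset.insert_subset_iff.1 hD
    obtain ⟨hb, hbB⟩ := Finset.mem_sdiff.1 hb
    refine (ih hD).tail ⟨⟨.bind p z₁ z₂, ?_⟩, hC.restrict subset_rfl ?_ ?_ ?_⟩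
    · obtain ⟨hne, T₁, T₂, h₁, h₂, h₃, h₄⟩ := hC'.binding _ _ _ hb
      refine ⟨hne, ?_, ⟨T₁, T₂, Finset.mem_filter.2 ⟨h₁, hC'.mem_Z_of_type h₁⟩,
        Finset.mem_filter.2 ⟨h₂, hC'.mem_Z_of_type h₂⟩, ?_, h₄⟩, ?_⟩
      · exact fun h => (Finset.mem_union.1 h).elim hbB hbD
      · exact (Finset.mem_union.1 h₃).resolve_left fun h =>
          hbB (hs z₁ (hC'.mem_Z_of_type h₁) T₁ h₁ p h z₂ hb)
      · simp only [Config.restrict, Finset.union_insert]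
    · rw [Finset.union_insert]
      exact Finset.insert_subset hb (Finset.union_subset hB (hD.trans Finset.sdiff_subset))
    · intro q y₁ y₂ h
      refine hC'.mem_of_binding (p := q) ?_
      rw [Finset.union_insert] at h
      exact Finset.insert_subset hb (Finset.union_subset hB (hD.trans Finset.sdiff_subset)) h
    · exact fun z hz T hT q hq z' h => Finset.mem_union_left _ (hs z hz T hT q hq z' h)

/-- A microservice can be created after all others if it is not a strong provider. -/
theorem Admissible.reach_of_del {I : Input k} {C : Config k} (hC : Admissible I C) {z : ℕ}
    {T : MType k} (hz : (z, T) ∈ C.T)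
    (hT : ∀ z₁ T₁, (z₁, T₁) ∈ C.T → ¬ StrongDep I.U T₁ T) :
    Relation.ReflTransGen (Move I) (C.del z) C := by
  have hC' := hC.provCorrect.isConfig
  have hzZ := hC'.mem_Z_of_type hz
  obtain ⟨o, ho⟩ := hC'.exists_node hzZ
  set B := C.B.filter fun b => (z ≠ b.2.1 ∧ z ≠ b.2.2) ∨ (b.2.1 = z ∧ b.1 ∈ dom T.reqS)
  have hs : ∀ z₁ ∈ C.Z, ∀ T₁, (z₁, T₁) ∈ C.T → ∀ p ∈ dom T₁.reqS, ∀ z', (p, z₁, z') ∈ C.B →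
      (p, z₁, z') ∈ B := by
    intro z₁ hz₁ T₁ hT₁ p hp z' h
    refine Finset.mem_filter.2 ⟨h, ?_⟩
    by_cases hzz : z = z₁
    · subst hzz
      obtain rfl := hC'.T_functional _ _ _ hz hT₁
      exact Or.inr ⟨rfl, hp⟩
    · refine Or.inl ⟨hzz, ?_⟩
      rintro rfl
      obtain ⟨-, T₁', T', h₁, h₂, -, h₃⟩ := hC'.binding _ _ _ h
      obtain rfl := hC'.T_functional _ _ _ hz h₂
      exact hT z₁ T₁ hT₁ ⟨hC.types _ _ hT₁, hC.types _ _ hz, p, Finset.mem_inter.2 ⟨hp, h₃⟩⟩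
  refine .head ⟨⟨.new z T o ((dom T.reqS).image fun p =>
    (p, C.Z.filter fun z' => (p, z, z') ∈ C.B)), ?_⟩,
    hC.restrict subset_rfl (Finset.filter_subset _ _) (fun p z₁ z₂ h =>
      hC'.mem_of_binding (Finset.mem_filter.1 h).1) hs⟩
    (hC.reach_add_bindings (Finset.filter_subset _ _) hs)
  have hBs : ∀ p S, (p, S) ∈ ((dom T.reqS).image fun p =>
      (p, C.Z.filter fun z' => (p, z, z') ∈ C.B)) ↔
      p ∈ dom T.reqS ∧ S = C.Z.filter fun z' => (p, z, z') ∈ C.B := by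
    intro p S
    simp only [Finset.mem_image, Prod.mk.injEq]
    constructor
    · rintro ⟨q, hq, rfl, rfl⟩
      exact ⟨hq, rfl⟩
    · rintro ⟨hq, rfl⟩
      exact ⟨p, hq, rfl, rfl⟩
  refine ⟨⟨hC'.isType z T hz, ?_, ?_, ?_, ?_⟩, ?_, ?_, ?_⟩
  · intro p S S' h h'
    rw [((hBs _ _).1 h).2, ((hBs _ _).1 h').2]
  · ext p
    rw [mem_dom]
    exact ⟨fun ⟨S, h⟩ => ((hBs _ _).1 h).1, fun h => ⟨_, (hBs _ _).2 ⟨h, rfl⟩⟩⟩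
  · intro p S h hzS
    rw [((hBs _ _).1 h).2] at hzS
    exact (hC'.binding _ _ _ (Finset.mem_filter.1 hzS).2).1 rfl
  · intro p S n h hn
    rw [((hBs _ _).1 h).2]
    obtain ⟨S', h₁, rfl, h₃⟩ := hC.provCorrect.strong z T hz p n hn
    exact Finset.card_le_card fun z' hz' => Finset.mem_filter.2
      ⟨Finset.mem_of_mem_erase (h₁ hz'), (h₃ z' hz').1⟩
  · exact Finset.notMem_erase _ _
  · intro p S h z' hz'
    rw [((hBs _ _).1 h).2] at hz'
    obtain ⟨hne, T₁, T', -, h₂, -, h₃⟩ := hC'.binding _ _ _ (Finset.mem_filter.1 hz').2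
    exact ⟨T', Finset.mem_filter.2 ⟨h₂, hne⟩, h₃⟩
  · have h₁ : insert z (C.Z.erase z) = C.Z := Finset.insert_erase hzZ
    have h₂ : insert (z, T) (C.T.filter fun x => z ≠ x.1) = C.T := by
      ext ⟨y, S⟩
      simp only [Finset.mem_insert, Finset.mem_filter, Prod.mk.injEq]
      constructor
      · rintro (⟨rfl, rfl⟩ | h)
        exacts [hz, h.1]
      · intro h
        by_cases hy : z = y
        · subst hy
          exact Or.inl ⟨rfl, hC'.T_functional _ _ _ h hz⟩
        · exact Or.inr ⟨h, hy⟩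
    have h₃ : insert (z, o) (C.N.filter fun x => z ≠ x.1) = C.N := by
      ext ⟨y, S⟩
      simp only [Finset.mem_insert, Finset.mem_filter, Prod.mk.injEq]
      constructor
      · rintro (⟨rfl, rfl⟩ | h)
        exacts [ho, h.1]
      · intro h
        by_cases hy : z = y
        · subst hy
          exact Or.inl ⟨rfl, hC'.N_functional _ _ _ h ho⟩
        · exact Or.inr ⟨h, hy⟩
    simp only [Config.restrict, Config.del, h₁, h₂, h₃, hC'.filter_T, hC'.filter_N]
    congr 1
    ext ⟨p, z₁, z₂⟩
    simp only [Finset.mem_union, Finset.mem_filter, Finset.mem_biUnion, Prod.exists, hBs,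
      Finset.mem_image, Prod.mk.injEq]
    constructor
    · rintro ⟨h, h' | h'⟩
      · exact Or.inl ⟨h, h'⟩
      · obtain ⟨rfl, hp⟩ := h'
        exact Or.inr ⟨p, _, ⟨hp, rfl⟩, z₂, Finset.mem_filter.2
          ⟨(hC'.mem_of_binding h).2, h⟩, rfl, rfl, rfl⟩
    · rintro (⟨h, h'⟩ | ⟨q, S, ⟨hq, rfl⟩, z', hz', rfl, rfl, rfl⟩)
      · exact ⟨h, Or.inl h'⟩
      · exact ⟨(Finset.mem_filter.1 hz').2, Or.inr ⟨rfl, hq⟩⟩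

theorem Admissible.reach_of_empty {I : Input k} (hwf : WellFormed I.U) (n : ℕ) :
    ∀ {C : Config k}, Admissible I C → C.Z.card = n →
      Relation.ReflTransGen (Move I) (Config.empty k) C := by
  induction n with
  | zero =>
    intro C hC hn
    rw [hC.provCorrect.isConfig.eq_empty (Finset.card_eq_zero.1 hn)]
  | succ n ih =>
    intro C hC hn
    obtain ⟨z, hz, T, hT, h⟩ := hC.exists_not_strongDep hwf (Finset.card_pos.1 (by omega))
    refine (ih (hC.del hT h) ?_).trans (hC.reach_of_del hT h)
    exact (Finset.card_erase_of_mem hz).trans (by omega)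

/-- Any two admissible configurations are connected, by way of the empty configuration. -/
theorem Admissible.reach {I : Input k} (hwf : WellFormed I.U) {C C' : Config k}
    (hC : Admissible I C) (hC' : Admissible I C') : Relation.ReflTransGen (Move I) C C' :=
  (hC.reach_empty hwf _ rfl).trans (hC'.reach_of_empty hwf _ rfl)

theorem exists_steps {I : Input k} {C C' : Config k}
    (h : Relation.ReflTransGen (Move I) C C') :
    ∃ as Cs, Steps C as Cs ∧ (∀ D ∈ Cs, Admissible I D) ∧ Cs.getLastD C = C' := by
  induction h using Relation.ReflTransGen.head_induction_on with
  | refl => exact ⟨[], [], .nil _, by simp, rfl⟩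
  | @head C D h _ ih =>
    obtain ⟨as, Cs, h₁, h₂, h₃⟩ := ih
    obtain ⟨⟨a, ha⟩, hD⟩ := h
    refine ⟨a :: as, D :: Cs, .cons ha h₁, ?_, by rw [List.getLastD_cons, h₃]⟩
    rintro E hE
    rcases List.mem_cons.1 hE with rfl | hE
    exacts [hD, h₂ E hE]

end Microservice

namespace Microservice

/-! ### Final configurations -/

variable {k : ℕ}

/-- The final configurations of nonempty solutions. -/
structure IsFinal (I : Input k) (F : Config k) : Prop where
  correct : F.Correct
  types : ∀ z T, (z, T) ∈ F.T → T ∈ I.U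
  nodes : ∀ z o, (z, o) ∈ F.N → o ∈ I.O
  target : ∃ z, (z, I.target) ∈ F.T

theorem IsFinal.admissible {I : Input k} {F : Config k} (h : IsFinal I F) : Admissible I F :=
  ⟨h.correct.provCorrect, h.types, h.nodes⟩

theorem IsFinal.exists_isDeployment {I : Input k} {F : Config k} (h : IsFinal I F) :
    ∃ τ ν b, IsDeployment I F.Z τ ν b ∧ F.Z.image ν = ran F.N := by
  classical
  have hF := h.correct.provCorrect.isConfig
  have hτ : ∀ z, ∃ T, z ∈ F.Z → (z, T) ∈ F.T := fun z => by
    by_cases hz : z ∈ F.Z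
    · exact (hF.exists_type hz).imp fun _ h _ => h
    · exact ⟨⟨∅, ∅, ∅, ∅, 0⟩, fun h => absurd h hz⟩
  have hν : ∀ z, ∃ o, z ∈ F.Z → (z, o) ∈ F.N := fun z => by
    by_cases hz : z ∈ F.Z
    · exact (hF.exists_node hz).imp fun _ h _ => h
    · exact ⟨⟨0, 0, 0⟩, fun h => absurd h hz⟩
  choose τ hτ using hτ
  choose ν hν using hν
  have hT : ∀ z T, (z, T) ∈ F.T → T = τ z := fun z T hz =>
    hF.T_functional _ _ _ hz (hτ z (hF.mem_Z_of_type hz))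
  have hN : ∀ z o, (z, o) ∈ F.N → o = ν z := fun z o hz =>
    hF.N_functional _ _ _ hz (hν z (hF.mem_Z_of_node hz))
  have hb : ∀ p z z', (p, z, z') ∈ F.B → z ≠ z' ∧ (τ z).Requires p ∧ p ∈ dom (τ z').prov := by
    intro p z z' hb
    obtain ⟨h₁, T₁, T₂, h₂, h₃, h₄, h₅⟩ := hF.binding p z z' hb
    rw [hT _ _ h₂] at h₄
    rw [hT _ _ h₃] at h₅
    exact ⟨h₁, h₄, h₅⟩
  obtain ⟨b, hbF⟩ : ∃ b : ℕ → ℕ → ℕ → Prop, ∀ p z z', b p z z' ↔ (p, z, z') ∈ F.B :=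
    ⟨_, fun _ _ _ => Iff.rfl⟩
  refine ⟨τ, ν, b, ⟨fun z hz => h.types z _ (hτ z hz), fun z hz => h.nodes z _ (hν z hz),
    fun o r => ?_, fun z _ z' _ p hzz => hb p z z' ((hbF _ _ _).1 hzz), ?_, ?_, ?_, ?_⟩, ?_⟩
  · by_cases ho : o ∈ ran F.N
    · refine le_trans (le_of_eq ?_) (h.correct.provCorrect.resources o ho r)
      refine Finset.sum_nbij' (fun z => (z, τ z)) Prod.fst ?_ ?_ ?_ ?_ ?_
      · intro z hz
        obtain ⟨hzZ, rfl⟩ := Finset.mem_filter.1 hz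
        exact Finset.mem_filter.2 ⟨hτ z hzZ, hν z hzZ⟩
      · intro x hx
        obtain ⟨h₁, h₂⟩ := Finset.mem_filter.1 hx
        exact Finset.mem_filter.2 ⟨hF.mem_Z_of_type h₁, (hN _ _ h₂).symm⟩
      · exact fun _ _ => rfl
      · intro x hx
        exact Prod.ext rfl (hT _ _ (Finset.mem_filter.1 hx).1).symm
      · exact fun _ _ => rfl
    · rw [Finset.filter_false_of_mem]
      · simp
      · rintro z hz rfl
        exact ho (mem_ran.2 ⟨z, hν z hz⟩)
  · intro z hz p n hn
    have hp : F.HasProviders p z n := by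
      rcases Finset.mem_union.1 hn with hn | hn
      · exact h.correct.provCorrect.strong z _ (hτ z hz) p n hn
      · exact h.correct.weak z _ (hτ z hz) p n hn
    obtain ⟨S, h₁, rfl, h₃⟩ := hp
    exact Finset.card_le_card fun z' hz' => Finset.mem_filter.2
      ⟨Finset.mem_of_mem_erase (h₁ hz'), (hbF _ _ _).2 (h₃ z' hz').1⟩
  · intro z hz p n hn
    refine le_trans (Nat.cast_le.2 ?_) (Config.not_hasRequirers_iff.1
      (h.correct.provCorrect.capacity z _ (hτ z hz) p n hn))
    refine Finset.card_le_card fun z' hz' => ?_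
    obtain ⟨h₁, h₂⟩ := Finset.mem_filter.1 hz'
    have h₃ := (hbF _ _ _).1 h₂
    exact Finset.mem_filter.2 ⟨Finset.mem_erase.2 ⟨(hb _ _ _ h₃).1, h₁⟩, h₃, τ z', hτ z' h₁,
      (hb _ _ _ h₃).2.1⟩
  · intro z hz p hp z' hz' hne
    exact h.correct.noConflict z _ (hτ z hz) p hp z' _ (hτ z' hz') hne
  · obtain ⟨z, hz⟩ := h.target
    exact ⟨z, hF.mem_Z_of_type hz, (hT _ _ hz).symm⟩
  · ext o
    rw [mem_ran, Finset.mem_image]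
    constructor
    · rintro ⟨z, hz, rfl⟩
      exact ⟨z, hν z hz⟩
    · rintro ⟨z, hz⟩
      exact ⟨z, hF.mem_Z_of_node hz, (hN _ _ hz).symm⟩

/-- A deployment gives a final configuration with microservices `0`, …, `n - 1`. -/
theorem IsDeployment.exists_isFinal {I : Input k} (hU : ∀ T ∈ I.U, T.IsType) {V : Finset ℕ}
    {τ : ℕ → MType k} {ν : ℕ → Node k} {b : ℕ → ℕ → ℕ → Prop} (hd : IsDeployment I V τ ν b)
    {a : ℕ} (ha : BoundedBy I.U a) :
    ∃ T ⊆ Finset.range V.card ×ˢ I.U, ∃ N ⊆ Finset.range V.card ×ˢ I.O,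
      ∃ B ⊆ Finset.range a ×ˢ (Finset.range V.card ×ˢ Finset.range V.card),
        IsFinal I ⟨Finset.range V.card, T, N, B⟩ ∧ ran N = V.image ν := by
  classical
  obtain ⟨e, he⟩ := (Finset.range V.card).finite_toSet.exists_bijOn_of_encard_eq
    (t := (V : Set ℕ)) (by
      rw [Set.encard_coe_eq_coe_finsetCard, Set.encard_coe_eq_coe_finsetCard, Finset.card_range])
  set n := V.card
  have hV : (Finset.range n).image e = V := by
    rw [← Finset.coe_inj, Finset.coe_image]
    exact he.image_eq
  have heV : ∀ i ∈ Finset.range n, e i ∈ V := fun i hi => he.mapsTo hi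
  have hinj : ∀ {s : Finset ℕ}, s ⊆ Finset.range n → Set.InjOn e s := fun h =>
    he.injOn.mono (by exact_mod_cast h)
  obtain ⟨T, hT⟩ : ∃ T : Finset (ℕ × MType k), ∀ i S, (i, S) ∈ T ↔
      i ∈ Finset.range n ∧ S = τ (e i) :=
    ⟨(Finset.range n).image fun i => (i, τ (e i)), fun i S => by
      simp only [Finset.mem_image, Prod.mk.injEq]
      exact ⟨by rintro ⟨j, hj, rfl, rfl⟩; exact ⟨hj, rfl⟩,
        by rintro ⟨hj, rfl⟩; exact ⟨i, hj, rfl, rfl⟩⟩⟩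
  obtain ⟨N, hN⟩ : ∃ N : Finset (ℕ × Node k), ∀ i o, (i, o) ∈ N ↔
      i ∈ Finset.range n ∧ o = ν (e i) :=
    ⟨(Finset.range n).image fun i => (i, ν (e i)), fun i S => by
      simp only [Finset.mem_image, Prod.mk.injEq]
      exact ⟨by rintro ⟨j, hj, rfl, rfl⟩; exact ⟨hj, rfl⟩,
        by rintro ⟨hj, rfl⟩; exact ⟨i, hj, rfl, rfl⟩⟩⟩
  have hreq : ∀ i ∈ Finset.range n, ∀ j ∈ Finset.range n, ∀ p, b p (e i) (e j) → i ≠ j ∧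
      (τ (e i)).Requires p ∧ p ∈ dom (τ (e j)).prov ∧ p < a := by
    intro i hi j hj p h
    obtain ⟨h₁, h₂, h₃⟩ := hd.binding _ (heV i hi) _ (heV j hj) p h
    obtain ⟨m, hm⟩ := MType.requires_iff.1 h₂
    exact ⟨fun h => h₁ (congrArg e h), h₂, h₃, ((ha _ (hd.type_mem _ (heV i hi))).1 _ hm).1⟩
  obtain ⟨B, hB, hBa⟩ : ∃ B : Finset (ℕ × ℕ × ℕ), (∀ p i j, (p, i, j) ∈ B ↔
      i ∈ Finset.range n ∧ j ∈ Finset.range n ∧ b p (e i) (e j)) ∧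
      B ⊆ Finset.range a ×ˢ (Finset.range n ×ˢ Finset.range n) := by
    refine ⟨(Finset.range a ×ˢ (Finset.range n ×ˢ Finset.range n)).filter
      fun x => b x.1 (e x.2.1) (e x.2.2), fun p i j => ?_, Finset.filter_subset _ _⟩
    rw [Finset.mem_filter, Finset.mem_product, Finset.mem_product, Finset.mem_range (n := a)]
    exact ⟨fun h => ⟨h.1.2.1, h.1.2.2, h.2⟩, fun h =>
      ⟨⟨(hreq i h.1 j h.2.1 p h.2.2).2.2.2, h.1, h.2.1⟩, h.2.2⟩⟩
  have hprov : ∀ i ∈ Finset.range n, ∀ p m, (p, m) ∈ (τ (e i)).reqS ∪ (τ (e i)).reqW →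
      Config.HasProviders ⟨Finset.range n, T, N, B⟩ p i m := by
    intro i hi p m hm
    rw [Config.hasProviders_iff]
    refine (hd.demand _ (heV i hi) p m hm).trans ?_
    rw [← hV, Finset.filter_image, Finset.card_image_of_injOn (hinj (Finset.filter_subset _ _))]
    refine Finset.card_le_card fun j hj => ?_
    obtain ⟨hj, h⟩ := Finset.mem_filter.1 hj
    obtain ⟨h₁, h₂, h₃, h₄⟩ := hreq i hi j hj p h
    exact Finset.mem_filter.2 ⟨Finset.mem_erase.2 ⟨h₁.symm, hj⟩, (hB _ _ _).2 ⟨hi, hj, h⟩,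
      _, (hT _ _).2 ⟨hj, rfl⟩, h₃⟩
  have hran : ran N = V.image ν := by
    ext o
    rw [mem_ran, ← hV, Finset.image_image, Finset.mem_image]
    exact exists_congr fun i => (hN i o).trans (and_congr_right fun _ => eq_comm)
  refine ⟨T, fun x hx => ?_, N, fun x hx => ?_, B, hBa, ⟨⟨⟨⟨?_, ?_, ?_, ?_, ?_, ?_⟩, ?_, ?_, ?_⟩,
    ?_, ?_⟩, ?_, ?_, ?_⟩, hran⟩
  · obtain ⟨h₁, h₂⟩ := (hT x.1 x.2).1 hx
    exact Finset.mem_product.2 ⟨h₁, h₂ ▸ hd.type_mem _ (heV _ h₁)⟩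
  · obtain ⟨h₁, h₂⟩ := (hN x.1 x.2).1 hx
    exact Finset.mem_product.2 ⟨h₁, h₂ ▸ hd.node_mem _ (heV _ h₁)⟩
  · intro i S S' h h'
    rw [((hT _ _).1 h).2, ((hT _ _).1 h').2]
  · ext i
    rw [mem_dom]
    exact ⟨fun ⟨S, h⟩ => ((hT _ _).1 h).1, fun h => ⟨_, (hT _ _).2 ⟨h, rfl⟩⟩⟩
  · intro i S h
    obtain ⟨hi, rfl⟩ := (hT _ _).1 h
    exact hU _ (hd.type_mem _ (heV i hi))
  · intro i S S' h h'
    rw [((hN _ _).1 h).2, ((hN _ _).1 h').2]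
  · ext i
    rw [mem_dom]
    exact ⟨fun ⟨S, h⟩ => ((hN _ _).1 h).1, fun h => ⟨_, (hN _ _).2 ⟨h, rfl⟩⟩⟩
  · intro p i j h
    obtain ⟨hi, hj, h⟩ := (hB _ _ _).1 h
    obtain ⟨h₁, h₂, h₃, h₄⟩ := hreq i hi j hj p h
    exact ⟨h₁, _, _, (hT _ _).2 ⟨hi, rfl⟩, (hT _ _).2 ⟨hj, rfl⟩, h₂, h₃⟩
  · intro o _ r
    refine le_trans (le_of_eq ?_) (hd.resources o r)
    rw [← hV, Finset.filter_image, Finset.sum_image (hinj (Finset.filter_subset _ _))]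
    refine Finset.sum_nbij' Prod.fst (fun i => (i, τ (e i))) ?_ ?_ ?_ ?_ ?_
    · intro x hx
      obtain ⟨-, h₂⟩ := Finset.mem_filter.1 hx
      obtain ⟨h₃, h₄⟩ := (hN _ _).1 h₂
      exact Finset.mem_filter.2 ⟨h₃, h₄.symm⟩
    · intro i hi
      obtain ⟨hi, h⟩ := Finset.mem_filter.1 hi
      exact Finset.mem_filter.2 ⟨(hT _ _).2 ⟨hi, rfl⟩, (hN _ _).2 ⟨hi, h.symm⟩⟩
    · intro x hx
      exact Prod.ext rfl ((hT x.1 x.2).1 (Finset.mem_filter.1 hx).1).2.symm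
    · exact fun _ _ => rfl
    · intro x hx
      rw [((hT x.1 x.2).1 (Finset.mem_filter.1 hx).1).2]
  · intro i S h p m hm
    obtain ⟨hi, rfl⟩ := (hT _ _).1 h
    exact hprov i hi p m (Finset.mem_union_left _ hm)
  · intro i S h p m hm
    obtain ⟨hi, rfl⟩ := (hT _ _).1 h
    rw [Config.not_hasRequirers_iff]
    refine le_trans (Nat.cast_le.2 ?_) (hd.capacity _ (heV i hi) p m hm)
    rw [← hV, Finset.filter_image, Finset.card_image_of_injOn (hinj (Finset.filter_subset _ _))]
    refine Finset.card_le_card fun j hj => ?_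
    obtain ⟨h₁, h₂, -⟩ := Finset.mem_filter.1 hj
    exact Finset.mem_filter.2 ⟨Finset.mem_of_mem_erase h₁, ((hB _ _ _).1 h₂).2.2⟩
  · intro i S h p m hm
    obtain ⟨hi, rfl⟩ := (hT _ _).1 h
    exact hprov i hi p m (Finset.mem_union_right _ hm)
  · intro i S h p hp j S' h' hne
    obtain ⟨hi, rfl⟩ := (hT _ _).1 h
    obtain ⟨hj, rfl⟩ := (hT _ _).1 h'
    exact hd.noConflict _ (heV i hi) p hp _ (heV j hj) fun h =>
      hne (he.injOn hj hi h)
  · intro i S h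
    obtain ⟨hi, rfl⟩ := (hT _ _).1 h
    exact hd.type_mem _ (heV i hi)
  · intro i S h
    obtain ⟨hi, rfl⟩ := (hN _ _).1 h
    exact hd.node_mem _ (heV i hi)
  · obtain ⟨z, hz, hzt⟩ := hd.target
    rw [← hV] at hz
    obtain ⟨i, hi, rfl⟩ := Finset.mem_image.1 hz
    exact ⟨i, (hT _ _).2 ⟨hi, hzt.symm⟩⟩

/-! ### Deciding whether all solutions have at least a given cost -/

/-- A nonempty solution exists as soon as there is a final configuration. Only the configurations
after the initial one have to be admissible; if the initial configuration uses other types or nodes,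
then the first action of a solution has to be a deletion that removes them. -/
def CanStart (I : Input k) : Prop :=
  Admissible I I.C₀ ∨ ∃ z ∈ I.C₀.Z, Admissible I (I.C₀.del z)

/-- A test whether all solutions have cost at least `c`: it examines the empty plan and, if there
are other plans, the final configurations of bounded size. -/
structure CostAtLeast (I : Input k) (a : ℕ) (c : ℕ∞) : Prop where
  bounded : BoundedBy I.U a
  empty_plan : I.C₀.Correct ∧ (∃ z, (z, I.target) ∈ I.C₀.T) → c ≤ I.C₀.cost
  small : CanStart I → ∀ n ∈ Finset.range (sizeBound a + 1),
    ∀ T ∈ (Finset.range n ×ˢ I.U).powerset, ∀ N ∈ (Finset.range n ×ˢ I.O).powerset,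
      ∀ B ∈ (Finset.range a ×ˢ (Finset.range n ×ˢ Finset.range n)).powerset,
        IsFinal I ⟨Finset.range n, T, N, B⟩ → c ≤ (Config.mk (Finset.range n) T N B).cost

/-- All actions but deletions keep the types and nodes of the initial configuration. -/
theorem canStart_of_step {I : Input k} (hI : I.Valid) {a : Action k} {C : Config k}
    (h : Step I.C₀ a C) (hC : Admissible I C) : CanStart I := by
  have key : I.C₀.T ⊆ C.T → I.C₀.N ⊆ C.N → CanStart I := fun hT hN => Or.inl
    ⟨hI.provCorrect, fun z T h => hC.types z T (hT h), fun z o h => hC.nodes z o (hN h)⟩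
  cases a with
  | bind p z₁ z₂ =>
    obtain ⟨-, -, -, rfl⟩ := h
    exact key subset_rfl subset_rfl
  | unbind p z₁ z₂ =>
    obtain ⟨-, -, -, rfl⟩ := h
    exact key subset_rfl subset_rfl
  | new z T o Bs =>
    obtain ⟨-, -, -, rfl⟩ := h
    exact key (Finset.subset_insert _ _) (Finset.subset_insert _ _)
  | del z =>
    obtain ⟨-, rfl⟩ := h
    by_cases hz : z ∈ I.C₀.Z
    · exact Or.inr ⟨z, hz, hC⟩
    · have hc := hI.provCorrect.isConfig
      refine key (fun x hx => Finset.mem_filter.2 ⟨hx, ?_⟩)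
        (fun x hx => Finset.mem_filter.2 ⟨hx, ?_⟩)
      · rintro rfl
        exact hz (hc.mem_Z_of_type hx)
      · rintro rfl
        exact hz (hc.mem_Z_of_node hx)

theorem IsFinal.exists_solution {I : Input k} (hwf : WellFormed I.U) {F : Config k}
    (hF : IsFinal I F) (hI : CanStart I) :
    ∃ as Cs, I.IsSolution as Cs ∧ Cs.getLastD I.C₀ = F := by
  have hreach : Relation.ReflTransGen (Move I) I.C₀ F := by
    rcases hI with h | ⟨z, -, h⟩
    · exact h.reach hwf hF.admissible
    · exact .head ⟨⟨.del z, trivial, rfl⟩, h⟩ (h.reach hwf hF.admissible)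
  obtain ⟨as, Cs, h₁, h₂, h₃⟩ := exists_steps hreach
  exact ⟨as, Cs, ⟨⟨h₁, fun C hC => (h₂ C hC).provCorrect, h₃ ▸ hF.correct⟩,
    fun C hC => (h₂ C hC).types, fun C hC => (h₂ C hC).nodes, h₃ ▸ hF.target⟩, h₃⟩

theorem getLastD_mem_of_ne_nil {α : Type*} {l : List α} (h : l ≠ []) (a : α) :
    l.getLastD a ∈ l := by
  rw [List.getLastD_eq_getLast?, List.getLast?_eq_some_getLast h]
  exact List.getLast_mem h

/-- The final configuration of a nonempty solution can be replaced by one of bounded size and no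
larger cost, which is again reachable. -/
theorem costAtLeast_iff {I : Input k} (hI : I.Valid) {a : ℕ} {c : ℕ∞}
    (ha : BoundedBy I.U a) : CostAtLeast I a c ↔
      ∀ as Cs, I.IsSolution as Cs → c ≤ (Cs.getLastD I.C₀).cost := by
  constructor
  · intro h as Cs hs
    have hsteps := hs.plan.steps
    cases hsteps with
    | nil => exact h.empty_plan ⟨hs.plan.correct, hs.target⟩
    | @cons C b C' as Cs hab hsteps =>
      set F := (C' :: Cs).getLastD I.C₀ with hF
      have hmem : F ∈ C' :: Cs := getLastD_mem_of_ne_nil (List.cons_ne_nil _ _) _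
      have hfin : IsFinal I F := ⟨hs.plan.correct, hs.types F hmem, hs.nodes F hmem, hs.target⟩
      have hstart := canStart_of_step hI hab ⟨hs.plan.provCorrect C' List.mem_cons_self,
        hs.types C' List.mem_cons_self, hs.nodes C' List.mem_cons_self⟩
      obtain ⟨τ, ν, b, hd, hν⟩ := hfin.exists_isDeployment
      obtain ⟨V, hV, hVc, b', hd'⟩ := hd.exists_card_le ha
      obtain ⟨T, hT, N, hN, B, hB, hf, hr⟩ := hd'.exists_isFinal hI.isType ha
      refine (h.small hstart V.card (Finset.mem_range.2 (Nat.lt_succ_of_le hVc)) T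
        (Finset.mem_powerset.2 hT) N (Finset.mem_powerset.2 hN) B (Finset.mem_powerset.2 hB)
        hf).trans (Nat.cast_le.2 ?_)
      rw [Config.cost, Config.cost, hr, ← hν]
      exact Finset.sum_le_sum_of_subset (Finset.image_subset_image hV)
  · intro h
    refine ⟨ha, fun h' => h [] [] ⟨⟨.nil _, by simp, h'.1⟩, by simp, by simp, h'.2⟩, ?_⟩
    intro hs n _ T _ N _ B _ hF
    obtain ⟨as, Cs, h₁, h₂⟩ := hF.exists_solution hI.wellFormed hs
    rw [← h₂]
    exact h as Cs h₁

theorem exists_boundedBy (U : Finset (MType k)) : ∃ a, BoundedBy U a := by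
  refine ⟨∑ T ∈ U, (∑ x ∈ T.reqS ∪ T.reqW, (x.1 + 1 + x.2) + ∑ x ∈ T.prov, x.2.toNat),
    fun T hT => ?_⟩
  have h := Finset.single_le_sum (f := fun T : MType k =>
    ∑ x ∈ T.reqS ∪ T.reqW, (x.1 + 1 + x.2) + ∑ x ∈ T.prov, x.2.toNat)
    (fun _ _ => Nat.zero_le _) hT
  refine ⟨fun x hx => ?_, fun x hx => or_iff_not_imp_left.2 fun hx' => ?_⟩
  · have h' := Finset.single_le_sum (f := fun x : ℕ × ℕ => x.1 + 1 + x.2)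
      (fun _ _ => Nat.zero_le _) hx
    omega
  · have h' := Finset.single_le_sum (f := fun x : ℕ × ℕ∞ => x.2.toNat)
      (fun _ _ => Nat.zero_le _) hx
    rw [← ENat.natCast_toNat hx']
    refine Nat.cast_le.2 ?_
    omega

/-! ### Searching for an optimal solution -/

/-- Executions as lists of consecutive transitions, the form in which they are tested. -/
theorem exists_path_of_steps {C : Config k} {as : List (Action k)} {Cs : List (Config k)}
    (h : Steps C as Cs) : ∃ L : List (Config k × Action k × Config k),
      L.map (fun x => x.2.1) = as ∧ L.map (fun x => x.2.2) = Cs ∧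
      (∀ x ∈ L, Step x.1 x.2.1 x.2.2) ∧
      C :: L.map (fun x => x.2.2) = L.map (fun x => x.1) ++ [Cs.getLastD C] := by
  induction h with
  | nil C => exact ⟨[], rfl, rfl, by simp, rfl⟩
  | @cons C a C' as Cs h _ ih =>
    obtain ⟨L, h₁, h₂, h₃, h₄⟩ := ih
    refine ⟨(C, a, C') :: L, by simp [h₁], by simp [h₂], ?_, ?_⟩
    · rintro x hx
      rcases List.mem_cons.1 hx with rfl | hx
      exacts [h, h₃ x hx]
    · rw [List.getLastD_cons, List.map_cons, List.map_cons, List.cons_append, ← h₄]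

theorem steps_of_path {F : Config k} (L : List (Config k × Action k × Config k)) :
    ∀ {C : Config k}, (∀ x ∈ L, Step x.1 x.2.1 x.2.2) →
      C :: L.map (fun x => x.2.2) = L.map (fun x => x.1) ++ [F] →
      Steps C (L.map fun x => x.2.1) (L.map fun x => x.2.2) ∧
        (L.map fun x => x.2.2).getLastD C = F := by
  induction L with
  | nil =>
    intro C _ h
    exact ⟨.nil _, (List.cons.inj h).1⟩
  | cons x L ih =>
    intro C hs h
    rw [List.map_cons, List.map_cons, List.cons_append] at h
    obtain ⟨rfl, h'⟩ := List.cons.inj h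
    obtain ⟨h₁, h₂⟩ := ih (fun y hy => hs y (List.mem_cons_of_mem _ hy)) h'
    refine ⟨.cons (hs x List.mem_cons_self) h₁, ?_⟩
    rw [List.map_cons, List.getLastD_cons]
    exact h₂

/-- A decidable form of well-formedness: every nonempty set of types has a member on which no member
depends. -/
theorem wellFormed_iff {U : Finset (MType k)} : WellFormed U ↔
    ∀ S ∈ U.powerset, S ≠ ∅ → ∃ T ∈ S, ∀ T₁ ∈ S, dom T₁.reqS ∩ dom T.prov = ∅ := by
  classical
  constructor
  · intro h S hS hne
    rw [Finset.mem_powerset] at hS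
    obtain ⟨T, hT, h⟩ := h.exists_not_strongDep (Finset.nonempty_iff_ne_empty.2 hne)
    exact ⟨T, hT, fun T₁ h₁ => Finset.eq_empty_of_forall_notMem fun p hp =>
      h T₁ h₁ ⟨hS h₁, hS hT, p, hp⟩⟩
  · intro h T hT
    have hU : ∀ {T}, Relation.TransGen (StrongDep U) T T → T ∈ U := fun hT => by
      obtain ⟨T', -, hT'⟩ := Relation.TransGen.tail'_iff.1 hT
      exact hT'.2.1
    -- The types on cycles form a set in which every member has a predecessor.
    obtain ⟨T₁, h₁, h₂⟩ := h (U.filter fun T => Relation.TransGen (StrongDep U) T T)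
      (Finset.mem_powerset.2 (Finset.filter_subset _ _))
      (Finset.ne_empty_of_mem (Finset.mem_filter.2 ⟨hU hT, hT⟩))
    obtain ⟨T₂, h₃, h₄⟩ := Relation.TransGen.tail'_iff.1 (Finset.mem_filter.1 h₁).2
    have h₅ : Relation.TransGen (StrongDep U) T₂ T₂ := Relation.TransGen.head' h₄ h₃
    obtain ⟨-, -, p, hp⟩ := id h₄
    have h₆ := h₂ T₂ (Finset.mem_filter.2 ⟨hU h₅, h₅⟩)
    rw [h₆] at hp
    exact Finset.notMem_empty _ hp

/-- The consecutive transitions in `L` form a solution that ends in `F`, and the test for `F.cost`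
with the bound `a` succeeds, so that the solution is optimal. -/
structure IsOptimalPath (I : Input k) (L : List (Config k × Action k × Config k)) (F : Config k)
    (a : ℕ) : Prop where
  path : I.C₀ :: L.map (fun x => x.2.2) = L.map (fun x => x.1) ++ [F]
  step : ∀ x ∈ L, Step x.1 x.2.1 x.2.2
  admissible : ∀ x ∈ L, Admissible I x.2.2
  correct : F.Correct
  target : ∃ z, (z, I.target) ∈ F.T
  optimal : CostAtLeast I a F.cost

theorem IsOptimalPath.isOptimal {I : Input k} (hI : I.Valid)
    {L : List (Config k × Action k × Config k)} {F : Config k} {a : ℕ}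
    (h : IsOptimalPath I L F a) : I.IsOptimal (L.map fun x => x.2.1) := by
  obtain ⟨h₁, h₂⟩ := steps_of_path L h.step h.path
  have hadm : ∀ C ∈ L.map (fun x => x.2.2), Admissible I C := by
    intro C hC
    obtain ⟨x, hx, rfl⟩ := List.mem_map.1 hC
    exact h.admissible x hx
  refine ⟨L.map fun x => x.2.2, ⟨⟨h₁, fun C hC => (hadm C hC).provCorrect, h₂ ▸ h.correct⟩,
    fun C hC => (hadm C hC).types, fun C hC => (hadm C hC).nodes, h₂ ▸ h.target⟩, ?_⟩
  intro as Cs hs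
  rw [h₂]
  exact Nat.cast_le.1 ((costAtLeast_iff hI h.optimal.bounded).1 h.optimal as Cs hs)

/-- There is an optimal path, or no cost is attained by a solution. -/
theorem exists_isOptimalPath_or {I : Input k} (hI : I.Valid) :
    (∃ L F a, IsOptimalPath I L F a) ∨ ∃ a, CostAtLeast I a ⊤ := by
  classical
  obtain ⟨a, ha⟩ := exists_boundedBy I.U
  by_cases h : ∃ n as Cs, I.IsSolution as Cs ∧ (Cs.getLastD I.C₀).cost = n
  · obtain ⟨as, Cs, hs, hn⟩ := Nat.find_spec h
    obtain ⟨L, rfl, rfl, h₃, h₄⟩ := exists_path_of_steps hs.plan.steps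
    refine Or.inl ⟨L, _, a, h₄, h₃, fun x hx => ?_, hs.plan.correct, hs.target,
      (costAtLeast_iff hI ha).2 fun as' Cs' hs' => Nat.cast_le.2 ?_⟩
    · have hx' : x.2.2 ∈ L.map fun x => x.2.2 := List.mem_map.2 ⟨x, hx, rfl⟩
      exact ⟨hs.plan.provCorrect _ hx', hs.types _ hx', hs.nodes _ hx'⟩
    · rw [hn]
      exact Nat.find_min' h ⟨as', Cs', hs', rfl⟩
  · refine Or.inr ⟨a, (costAtLeast_iff hI ha).2 fun as Cs hs => ?_⟩
    exact absurd ⟨_, as, Cs, hs, rfl⟩ h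

section Primrec

variable {α : Type*} [Primcodable α]

@[fun_prop]
theorem primrecPred_admissible {f : α → Input k} {g : α → Config k} (hf : Primrec f)
    (hg : Primrec g) : PrimrecPred fun a => Admissible (f a) (g a) := by
  have h₁ : PrimrecPred fun a => ∀ z T, (z, T) ∈ (g a).T → T ∈ (f a).U :=
    primrecPred_forall_mem_pair (p := fun a _ T => T ∈ (f a).U) (by fun_prop) (by fun_prop)
  have h₂ : PrimrecPred fun a => ∀ z o, (z, o) ∈ (g a).N → o ∈ (f a).O :=
    primrecPred_forall_mem_pair (p := fun a _ o => o ∈ (f a).O) (by fun_prop) (by fun_prop)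
  exact ((primrecPred_provCorrect hg).and (h₁.and h₂)).of_eq fun a =>
    ⟨fun ⟨h₁, h₂, h₃⟩ => ⟨h₁, h₂, h₃⟩, fun h => ⟨h.1, h.2, h.3⟩⟩

@[fun_prop]
theorem primrecPred_exists_target {f : α → Input k} {g : α → Config k} (hf : Primrec f)
    (hg : Primrec g) : PrimrecPred fun a => ∃ z, (z, (f a).target) ∈ (g a).T :=
  PrimrecPred.of_eq (p := fun a => (f a).target ∈ ran (g a).T) (by fun_prop) fun _ => mem_ran

@[fun_prop]
theorem primrecPred_isFinal {f : α → Input k} {g : α → Config k} (hf : Primrec f)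
    (hg : Primrec g) : PrimrecPred fun a => IsFinal (f a) (g a) :=
  ((primrecPred_admissible hf hg).and ((primrecPred_correct hg).and
    (primrecPred_exists_target hf hg))).of_eq fun _ =>
      ⟨fun ⟨h₁, h₂, h₃⟩ => ⟨h₂, h₁.types, h₁.nodes, h₃⟩,
        fun h => ⟨h.admissible, h.correct, h.target⟩⟩

theorem primrec_zeroSumStep : Primrec zeroSumStep :=
  Primrec.of_eq (f := fun x : ℕ × ℕ × ℕ × ℕ => ((2 * x.1 + 1) * x.1,
    x.2.1 + (x.1 * x.1 * x.1 + x.1 * x.1 + x.2.1) * x.1, x.2.2.1 * (2 * x.1 + 1),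
    x.2.2.2 + x.2.2.1 * (x.1 * x.1 * x.1 + x.1 * x.1 + x.2.1))) (by fun_prop) fun _ => rfl

@[fun_prop]
theorem primrec_sizeBound {f : α → ℕ} (hf : Primrec f) : Primrec fun a => sizeBound (f a) := by
  have h : Primrec fun a => zeroSumStep^[a] (a, protectedBound a * a, 1, 0) :=
    Primrec.nat_iterate (f := fun a => a) (g := fun a => (a, protectedBound a * a, 1, 0))
      (h := fun _ => zeroSumStep) (by fun_prop) (by unfold protectedBound; fun_prop)
      (primrec_zeroSumStep.comp Primrec.snd)
  have h' : Primrec sizeBound := by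
    unfold sizeBound protectedBound at *
    fun_prop
  exact h'.comp hf

@[fun_prop]
theorem primrecPred_boundedBy {f : α → Finset (MType k)} {g : α → ℕ} (hf : Primrec f)
    (hg : Primrec g) : PrimrecPred fun a => BoundedBy (f a) (g a) :=
  PrimrecPred.forall_finset (by fun_prop) (PrimrecPred.and
    (PrimrecPred.forall_finset (by fun_prop) (by fun_prop))
    (PrimrecPred.forall_finset (by fun_prop) (by fun_prop)))

@[fun_prop]
theorem primrecPred_canStart {f : α → Input k} (hf : Primrec f) :
    PrimrecPred fun a => CanStart (f a) :=
  PrimrecPred.or (by fun_prop) (PrimrecPred.exists_finset (by fun_prop) (by fun_prop))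

@[fun_prop]
theorem primrecPred_costAtLeast {f : α → Input k} {a : α → ℕ} {c : α → ℕ∞} (hf : Primrec f)
    (ha : Primrec a) (hc : Primrec c) : PrimrecPred fun x => CostAtLeast (f x) (a x) (c x) := by
  have h : PrimrecPred fun x => CanStart (f x) → ∀ n ∈ Finset.range (sizeBound (a x) + 1),
      ∀ T ∈ (Finset.range n ×ˢ (f x).U).powerset, ∀ N ∈ (Finset.range n ×ˢ (f x).O).powerset,
        ∀ B ∈ (Finset.range (a x) ×ˢ (Finset.range n ×ˢ Finset.range n)).powerset,
          IsFinal (f x) ⟨Finset.range n, T, N, B⟩ →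
            c x ≤ (Config.mk (Finset.range n) T N B).cost := by
    refine PrimrecPred.imp (by fun_prop) ?_
    refine PrimrecPred.forall_finset (by fun_prop) (PrimrecPred.forall_finset (by fun_prop) ?_)
    refine PrimrecPred.forall_finset (by fun_prop) (PrimrecPred.forall_finset (by fun_prop) ?_)
    fun_prop
  have h' : PrimrecPred fun x => BoundedBy (f x).U (a x) ∧
      ((f x).C₀.Correct ∧ (∃ z, (z, (f x).target) ∈ (f x).C₀.T) → c x ≤ (f x).C₀.cost) := by
    fun_prop
  exact (h'.and h).of_eq fun x => ⟨fun h => ⟨h.1.1, h.1.2, h.2⟩, fun h => ⟨⟨h.1, h.2⟩, h.3⟩⟩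

@[fun_prop]
theorem primrecPred_valid {f : α → Input k} (hf : Primrec f) :
    PrimrecPred fun a => (f a).Valid := by
  have h₁ : PrimrecPred fun a => ∀ T ∈ (f a).U, T.IsType :=
    PrimrecPred.forall_finset (by fun_prop) (by fun_prop)
  have h₂ : PrimrecPred fun a => WellFormed (f a).U := by
    simp only [wellFormed_iff]
    refine PrimrecPred.forall_finset (by fun_prop) (PrimrecPred.imp (by fun_prop) ?_)
    refine PrimrecPred.exists_finset (by fun_prop) ?_
    exact PrimrecPred.forall_finset (by fun_prop) (by fun_prop)
  have h : PrimrecPred fun a => (∀ T ∈ (f a).U, T.IsType) ∧ WellFormed (f a).U ∧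
      (f a).C₀.ProvCorrect ∧ (f a).target ∈ (f a).U := by
    fun_prop
  exact h.of_eq fun a => ⟨fun ⟨h₁, h₂, h₃, h₄⟩ => ⟨h₁, h₂, h₃, h₄⟩,
    fun h => ⟨h.1, h.2, h.3, h.4⟩⟩

@[fun_prop]
theorem primrecPred_isOptimalPath {f : α → Input k}
    {L : α → List (Config k × Action k × Config k)} {F : α → Config k} {a : α → ℕ}
    (hf : Primrec f) (hL : Primrec L) (hF : Primrec F) (ha : Primrec a) :
    PrimrecPred fun x => IsOptimalPath (f x) (L x) (F x) (a x) := by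
  have h₁ : PrimrecPred fun x => (f x).C₀ :: (L x).map (fun y => y.2.2) =
      (L x).map (fun y => y.1) ++ [F x] := by
    refine PrimrecPred.eq (Primrec.list_cons.comp (by fun_prop) ?_)
      (Primrec.list_append.comp ?_ (Primrec.list_cons.comp hF (Primrec.const [])))
    · exact Primrec.list_map hL (Primrec.comp (f := fun y : α × (Config k × Action k × Config k) =>
        y.2.2.2) (by fun_prop) Primrec.id)
    · exact Primrec.list_map hL (Primrec.comp (f := fun y : α × (Config k × Action k × Config k) =>
        y.2.1) (by fun_prop) Primrec.id)
  have h₂ : PrimrecPred fun x => ∀ y ∈ L x, Step y.1 y.2.1 y.2.2 :=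
    PrimrecPred.forall_list hL (primrecPred_step (by fun_prop) (by fun_prop) (by fun_prop))
  have h₃ : PrimrecPred fun x => ∀ y ∈ L x, Admissible (f x) y.2.2 :=
    PrimrecPred.forall_list hL (by fun_prop)
  have h₄ : PrimrecPred fun x => (F x).Correct ∧ (∃ z, (z, (f x).target) ∈ (F x).T) ∧
      CostAtLeast (f x) (a x) (F x).cost := by
    refine PrimrecPred.and (by fun_prop) (PrimrecPred.and (by fun_prop)
      (primrecPred_costAtLeast (by fun_prop) (by fun_prop) ?_))
    exact Primrec.option_some.comp (by fun_prop)
  exact (h₁.and (h₂.and (h₃.and h₄))).of_eq fun x =>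
    ⟨fun ⟨h₁, h₂, h₃, h₄, h₅, h₆⟩ => ⟨h₁, h₂, h₃, h₄, h₅, h₆⟩,
      fun h => ⟨h.1, h.2, h.3, h.4, h.5, h.6⟩⟩

end Primrec

end Microservice

theorem theorem1 (k : ℕ) :
    ∃ f : Microservice.Input k → Option (List (Microservice.Action k)),
      Computable f ∧
        ∀ I : Microservice.Input k, I.Valid →
          (∀ as, f I = some as → I.IsOptimal as) ∧
          (f I = none → ¬ ∃ as Cs, I.IsSolution as Cs) := by
  open Microservice in
  -- The search ranges over a flag that tells whether there is a solution, a path, its last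
  -- configuration, and a bound on the numbers in the universe.
  obtain ⟨g, hg, hspec⟩ := PrimrecPred.exists_computable
    (p := fun (I : Input k) (y : Bool × List (Config k × Action k × Config k) × Config k × ℕ) =>
      I.Valid → (y.1 = true ∧ IsOptimalPath I y.2.1 y.2.2.1 y.2.2.2) ∨
        (y.1 = false ∧ CostAtLeast I y.2.2.2 ⊤)) (by fun_prop) (fun I => by
      by_cases hI : I.Valid
      swap
      · exact ⟨(true, [], I.C₀, 0), fun h => absurd h hI⟩
      rcases exists_isOptimalPath_or hI with ⟨L, F, a, h⟩ | ⟨a, h⟩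
      · exact ⟨(true, L, F, a), fun _ => Or.inl ⟨rfl, h⟩⟩
      · exact ⟨(false, [], I.C₀, a), fun _ => Or.inr ⟨rfl, h⟩⟩)
  refine ⟨fun I => bif (g I).1 then some ((g I).2.1.map fun x => x.2.1) else none, ?_,
    fun I hI => ?_⟩
  · have h : Primrec fun y : Bool × List (Config k × Action k × Config k) × Config k × ℕ =>
        bif y.1 then some (y.2.1.map fun x => x.2.1) else none := by
      refine Primrec.cond (by fun_prop) (Primrec.option_some.comp ?_) (Primrec.const none)
      exact Primrec.list_map (by fun_prop) (Primrec.comp (f := fun y :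
        (Bool × List (Config k × Action k × Config k) × Config k × ℕ) ×
          (Config k × Action k × Config k) => y.2.2.1) (by fun_prop) Primrec.id)
    exact h.to_comp.comp hg
  · rcases hspec I hI with ⟨h₁, h₂⟩ | ⟨h₁, h₂⟩
    · simp only [h₁, cond_true, Option.some.injEq, reduceCtorEq, false_imp_iff, and_true]
      rintro as rfl
      exact h₂.isOptimal hI
    · simp only [h₁, cond_false, reduceCtorEq, false_imp_iff, implies_true, true_and,
        forall_const]
      rintro ⟨as, Cs, hs⟩
      have := (costAtLeast_iff hI h₂.bounded).1 h₂ as Cs hs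
      exact absurd (top_le_iff.1 this) (ENat.natCast_ne_top _)
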